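/- Notation. For $d\in\mathbb N$ let $\mathcal S_d$ be the space of symmetric real $d\times d$ matrices and $\mathcal S_d^+$ the closed cone of positive semidefinite ones; $\|\cdot\|_2$ is the Euclidean norm, $\|A\|_F=\sqrt{\operatorname{tr}(A^\top A)}$, $\sqrt Q$ is the positive semidefinite square root of $Q\in\mathcal S_d^+$, and $\mathcal N(0,Q)$ is the centred Gaussian law on $\mathbb R^d$ with covariance matrix $Q$. Let $L$ and $D_1,\dots,D_{L+1}$ be fixed natural numbers. For $\ell=1,\dots,L$ let $\mathcal G^{(\ell)}:\mathbb R^{D_\ell}\to\mathcal S^+_{D_{\ell+1}}$ be continuous and such that for every $\varepsilon>0$ there is $C_\varepsilon>0$ with $$\|\mathcal G^{(\ell)}(z)-\mathcal G^{(\ell)}(z')\|_F\le C_\varepsilon\bigl[1+\|z-z'\|_2(\|z\|_2+\|z'\|_2)\bigr]+\varepsilon\bigl(\|z\|_2^2+\|z'\|_2^2\bigr)\qquad\text{for all } z,z'\in\mathbb R^{D_\ell}.$$ Let $C_\ell(n)\in\mathbb N$ ($\ell=1,\dots,L$, $n\ge1$) satisfy $C_\ell(n)/n\to\alpha_\ell\in(0,\infty)$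 as $n\to\infty$. Fix a deterministic matrix $\mathbf K^{(1)}\in\mathcal S^+_{D_1}$. For each $n\ge 1$ let $\mathbf K^{(1,n)},\dots,\mathbf K^{(L+1,n)}$ be a Markov sequence of random matrices with values in $\mathcal S^+_{D_1}\times\dots\times\mathcal S^+_{D_{L+1}}$, defined on a common probability space, with $\mathbf K^{(1,n)}=\mathbf K^{(1)}$ almost surely and transition kernels $$\nu_{\ell+1,n}(B\mid Q)=\mathbb P\Bigl\{\frac1{C_\ell(n)}\sum_{c=1}^{C_\ell(n)}\mathcal G^{(\ell)}\bigl(\sqrt Q\,Z^{(\ell)}_c\bigr)\in B\Bigr\},\qquad Z^{(\ell)}_c\overset{iid}{\sim}\mathcal N(0,\mathbf 1_{D_\ell}),$$ that is, the conditional law of $\mathbf K^{(\ell+1,n)}$ given $\mathbf K^{(1,n)},\dots,\mathbf K^{(\ell,n)}$ is $\nu_{\ell+1,n}(\cdot\mid\mathbf K^{(\ell,n)})$ for $\ell=1,\dots,L$. For $Q_1\in\mathcal S^+_{D_\ell}$ and $Q_2\in\mathcal S^+_{D_{\ell+1}}$ put $$I_\ell(Q_2\mid Q_1)=\sup_{Q_0\in\mathcal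 S_{D_{\ell+1}}}\Bigl\{\operatorname{tr}(Q_0^\top Q_2)-\log\int_{\mathbb R^{D_\ell}}e^{\operatorname{tr}(Q_0^\top\mathcal G^{(\ell)}(z))}\,\mathcal N(dz\mid 0,Q_1)\Bigr\}\in[0,+\infty],$$ with $\log(+\infty)=+\infty$. **Proposition (LDP for the general structure).** The sequence $\{(\mathbf K^{(2,n)},\dots,\mathbf K^{(L+1,n)})\}_{n\ge1}$ satisfies a large deviation principle on $\mathcal S^+_{D_2}\times\dots\times\mathcal S^+_{D_{L+1}}$ with speed $n$ and rate function $$I(Q_2,\dots,Q_{L+1})=\alpha_1 I_1\bigl(Q_2\mid\mathbf K^{(1)}\bigr)+\sum_{\ell=2}^L\alpha_\ell\, I_\ell(Q_{\ell+1}\mid Q_\ell),$$ and this rate function is good. Explicitly, $I$ takes values in $\mathbb R\cup\{+\infty\}$, is lower semicontinuous and has compact sublevel sets, and the laws $\mu_n$ of $(\mathbf K^{(2,n)},\dots,\mathbf K^{(L+1,n)})$ satisfy $$\liminf_{n\to\infty}\tfrac1n\log\mu_n(O)\ge-\inf_{O}I\ \text{ for every open } O,\qquad \limsup_{n\to\infty}\tfrac1n\log\mu_n(F)\le-\inf_{F}I\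 \text{ for every closed } F.$$ -/

import Mathlib

open MeasureTheory ProbabilityTheory Filter Topology
open scoped ENNReal

noncomputable section

namespace CovLDP

/-- The vector space `ℝ^d` with its Euclidean norm. -/
abbrev Vec (d : ℕ) : Type := EuclideanSpace ℝ (Fin d)

/-- The cone `𝒮⁺_d` of symmetric positive semidefinite real `d × d` matrices, with the topology
induced from the space of matrices. -/
abbrev PSD (d : ℕ) : Type := {Q : Matrix (Fin d) (Fin d) ℝ // Q.PosSemidef}

instance instMeasurableSpacePSD (d : ℕ) : MeasurableSpace (PSD d) := borel (PSD d)

instance instBorelSpacePSD (d : ℕ) : BorelSpace (PSD d) := ⟨rfl⟩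

instance instSecondCountablePSD (d : ℕ) : SecondCountableTopology (PSD d) := by
  have : SecondCountableTopology (Matrix (Fin d) (Fin d) ℝ) :=
    inferInstanceAs (SecondCountableTopology (Fin d → Fin d → ℝ))
  exact TopologicalSpace.Subtype.secondCountableTopology _

/-- The Frobenius norm `‖A‖_F = √(tr(Aᵀ A))`. -/
def frobNorm {d : ℕ} (A : Matrix (Fin d) (Fin d) ℝ) : ℝ :=
  Real.sqrt (A.transpose * A).trace

/-- The empirical mean `(1/C) ∑_c A_c` of positive semidefinite matrices. -/
def empMean {d C : ℕ} (A : Fin C → PSD d) : PSD d :=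
  ⟨(C : ℝ)⁻¹ • ∑ c, (A c).1,
    (Matrix.posSemidef_sum Finset.univ fun c _ => (A c).2).smul (by positivity)⟩

section

open scoped MatrixOrder

/-- `√Q z`, where `√Q` is the positive semidefinite square root of `Q`. -/
def sqrtMul {d : ℕ} (Q : PSD d) (z : Vec d) : Vec d :=
  Matrix.toEuclideanCLM (𝕜 := ℝ) (CFC.sqrt Q.1) z

end

/-- The transition kernel `ν(· | Q)`: the law of `(1/C) ∑_{c=1}^C g(√Q Z_c)` where
`Z_1, …, Z_C` are i.i.d. standard Gaussian vectors of `ℝ^d`. -/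
def transition {d d' : ℕ} (g : Vec d → PSD d') (C : ℕ) (Q : PSD d) : Measure (PSD d') :=
  (Measure.pi fun _ : Fin C => stdGaussian (Vec d)).map
    fun Z => empMean fun c => g (sqrtMul Q (Z c))

/-- `g` is continuous and for every `ε > 0` there is `C_ε > 0` such that
`‖g z - g z'‖_F ≤ C_ε (1 + ‖z - z'‖ (‖z‖ + ‖z'‖)) + ε (‖z‖² + ‖z'‖²)` for all `z, z'`. -/
def QuadraticIncrement {d d' : ℕ} (g : Vec d → PSD d') : Prop :=
  Continuous g ∧
    ∀ ε : ℝ, 0 < ε → ∃ Cε : ℝ, 0 < Cε ∧ ∀ z z' : Vec d,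
      frobNorm ((g z).1 - (g z').1) ≤
        Cε * (1 + ‖z - z'‖ * (‖z‖ + ‖z'‖)) + ε * (‖z‖ ^ 2 + ‖z'‖ ^ 2)

/-- `M(Q₀ | Q₁) = ∫ exp(tr(Q₀ᵀ g(z))) 𝒩(dz | 0, Q₁)`, an element of `[0, ∞]`. -/
def expMoment {d d' : ℕ} (g : Vec d → PSD d') (Q₁ : PSD d)
    (Q₀ : Matrix (Fin d') (Fin d') ℝ) : ℝ≥0∞ :=
  ∫⁻ z, ENNReal.ofReal (Real.exp (Q₀.transpose * (g z).1).trace) ∂(multivariateGaussian 0 Q₁.1)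

/-- The conditional Cramér rate `I(Q₂ | Q₁) = sup_{Q₀ symmetric} {tr(Q₀ᵀ Q₂) - log M(Q₀ | Q₁)}`,
with `log ∞ = ∞`. -/
def condRate {d d' : ℕ} (g : Vec d → PSD d') (Q₁ : PSD d) (Q₂ : PSD d') : EReal :=
  ⨆ Q₀ : {A : Matrix (Fin d') (Fin d') ℝ // A.IsSymm},
    (((Q₀.1.transpose * Q₂.1).trace : ℝ) : EReal) - ENNReal.log (expMoment g Q₁ Q₀.1)

/-- Given maps `G ℓ` for `ℓ = 0, …, L-1` (the transition from component `ℓ` to component `ℓ+1`)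
and the numbers of samples `C ℓ`, `X_0, …, X_L` is a Markov sequence of random positive
semidefinite matrices, started at the deterministic matrix `Q₀`, with transition kernels
`transition (G ℓ) (C ℓ)`: the conditional law of `X_{ℓ+1}` given `X_0, …, X_ℓ` is
`transition (G ℓ) (C ℓ) X_ℓ`. -/
structure IsCovChain {Ω : Type*} [MeasurableSpace Ω] (P : Measure Ω) {L : ℕ} {D : Fin (L + 1) → ℕ}
    (G : (ℓ : Fin L) → Vec (D ℓ.castSucc) → PSD (D ℓ.succ)) (C : Fin L → ℕ) (Q₀ : PSD (D 0))
    (X : (i : Fin (L + 1)) → Ω → PSD (D i)) : Prop where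
  measurable : ∀ i, Measurable (X i)
  init : ∀ᵐ ω ∂P, X 0 ω = Q₀
  markov : ∀ (ℓ : Fin L) (B : Set (PSD (D ℓ.succ))), MeasurableSet B →
    P[(X ℓ.succ ⁻¹' B).indicator (fun _ => (1 : ℝ)) |
        ⨆ i : {i : Fin (L + 1) // i ≤ ℓ.castSucc}, MeasurableSpace.comap (X i.1) inferInstance]
      =ᵐ[P] fun ω => (transition (G ℓ) (C ℓ) (X ℓ.castSucc ω)).real B

/-- `I : 𝕏 → ℝ ∪ {+∞}` is a good rate function: it is lower semicontinuous and has compact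
sublevel sets. -/
structure IsGoodRateFunction {𝕏 : Type*} [TopologicalSpace 𝕏] (I : 𝕏 → EReal) : Prop where
  ne_bot : ∀ x, I x ≠ ⊥
  lsc : LowerSemicontinuous I
  compact_sublevel : ∀ a : ℝ, IsCompact {x | I x ≤ (a : EReal)}

/-- The sequence of Borel measures `μ n` satisfies the large deviation lower and upper bounds
with speed `n` and rate `I`. -/
structure SatisfiesLDP {𝕏 : Type*} [TopologicalSpace 𝕏] [MeasurableSpace 𝕏]
    (μ : ℕ → Measure 𝕏) (I : 𝕏 → EReal) : Prop where
  lower : ∀ O : Set 𝕏, IsOpen O →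
    -(⨅ x ∈ O, I x) ≤ liminf (fun n : ℕ => ENNReal.log (μ n O) / (n : EReal)) atTop
  upper : ∀ F : Set 𝕏, IsClosed F →
    limsup (fun n : ℕ => ENNReal.log (μ n F) / (n : EReal)) atTop ≤ -(⨅ x ∈ F, I x)

/-- The rate function
`(Q_1, …, Q_L) ↦ ∑_{ℓ=0}^{L-1} α_ℓ I_ℓ(Q_{ℓ+1} | Q_ℓ)`, where `Q_0` is the deterministic
initial matrix of the chain. -/
def chainRate {L : ℕ} {D : Fin (L + 1) → ℕ}
    (G : (ℓ : Fin L) → Vec (D ℓ.castSucc) → PSD (D ℓ.succ)) (α : Fin L → ℝ) (Q₀ : PSD (D 0))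
    (Q : (ℓ : Fin L) → PSD (D ℓ.succ)) : EReal :=
  ∑ ℓ : Fin L, (α ℓ : EReal) *
    condRate (G ℓ) (Fin.cons (α := fun i => PSD (D i)) Q₀ Q ℓ.castSucc) (Q ℓ)

end CovLDP

end

noncomputable section

namespace CovLDP

/-! ### From bounds near points to a large deviation principle. -/

section LargeDeviations

/-! An LDP with good rate follows from exponential bounds near each point together with exponential
tightness (`SatisfiesPointwiseLDP`). Such bounds multiply along a Markov chain once they hold for
each transition uniformly over starting points `x'` near `x`; the rates then add up. Lower
semicontinuity and compact sublevel sets are consequences of the probability bounds, not of the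
formula for the rate.

From a fixed `x`, a transition is an empirical mean of i.i.d. matrices, so Cramér's theorem governs
it. As `G` may grow quadratically, exponential moments can be infinite, and the lower bound must do
without moment assumptions: truncate, add a quadratic penalty to the exponent, tilt by the minimiser
and use the weak law of large numbers (`eventually_exp_neg_le_pi_norm_mean_sub_lt`).

For uniformity, all starting points are driven by the same standard Gaussian sample. By
`QuadraticIncrement.eventually_norm_sub_le`, moving `x` to a nearby `x'` changes the summand by at
most `ε * (1 + ‖z‖ ^ 2)`, and small quadratic exponential moments of a Gaussian are close to one.
This error is removed by Chernoff's bound in `transition_lower` and by Hölder's inequality in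
`transition_upper`; `transition_tight` supplies compactness. -/

lemma log_ofReal_exp (x : ℝ) : ENNReal.log (ENNReal.ofReal (Real.exp x)) = (x : EReal) := by
  rw [ENNReal.log_ofReal_of_pos (Real.exp_pos x), Real.log_exp]

lemma log_div_le_of_le_exp {m : ℝ≥0∞} {n : ℕ} (hn : 0 < n) {a : ℝ}
    (h : m ≤ ENNReal.ofReal (Real.exp (-(n * a)))) :
    ENNReal.log m / (n : EReal) ≤ ((-a : ℝ) : EReal) := by
  have h' := ENNReal.log_monotone h
  rw [log_ofReal_exp] at h'
  rw [EReal.div_le_iff_le_mul (by exact_mod_cast hn) (EReal.natCast_ne_top n)]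
  refine h'.trans (le_of_eq ?_)
  rw [show ((n : ℕ) : EReal) = ((n : ℝ) : EReal) from rfl, ← EReal.coe_mul]
  congr 1; ring

lemma le_log_div_of_exp_le {m : ℝ≥0∞} {n : ℕ} (hn : 0 < n) {a : ℝ}
    (h : ENNReal.ofReal (Real.exp (-(n * a))) ≤ m) :
    ((-a : ℝ) : EReal) ≤ ENNReal.log m / (n : EReal) := by
  have h' := ENNReal.log_monotone h
  rw [log_ofReal_exp] at h'
  rw [EReal.le_div_iff_mul_le (by exact_mod_cast hn) (EReal.natCast_ne_top n)]
  refine le_trans (le_of_eq ?_) h'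
  rw [show ((n : ℕ) : EReal) = ((n : ℝ) : EReal) from rfl, ← EReal.coe_mul]
  congr 1; ring

lemma exp_neg_mul_lt_exp_neg_mul {n : ℕ} (hn : 0 < n) {a b : ℝ} (h : a < b) :
    ENNReal.ofReal (Real.exp (-(n * b))) < ENNReal.ofReal (Real.exp (-(n * a))) := by
  rw [ENNReal.ofReal_lt_ofReal_iff (Real.exp_pos _), Real.exp_lt_exp]
  have : (0 : ℝ) < n := by exact_mod_cast hn
  nlinarith

lemma eventually_const_mul_exp_neg_le (N : ℝ) {a b : ℝ} (h : a < b) :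
    ∀ᶠ n : ℕ in atTop, ENNReal.ofReal N * ENNReal.ofReal (Real.exp (-(n * b))) ≤
      ENNReal.ofReal (Real.exp (-(n * a))) := by
  have h1 : Tendsto (fun n : ℕ => Real.exp ((n : ℝ) * (b - a))) atTop atTop :=
    Real.tendsto_exp_atTop.comp
      (tendsto_natCast_atTop_atTop.atTop_mul_const (sub_pos.2 h))
  filter_upwards [h1.eventually_ge_atTop N] with n hn
  rw [← ENNReal.ofReal_mul' (Real.exp_pos _).le]
  refine ENNReal.ofReal_le_ofReal ?_
  calc N * Real.exp (-(n * b)) ≤ Real.exp ((n : ℝ) * (b - a)) * Real.exp (-(n * b)) := by gcongr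
    _ = Real.exp (-(n * a)) := by rw [← Real.exp_add]; ring_nf

variable {𝕏 : Type*} [TopologicalSpace 𝕏] [MeasurableSpace 𝕏]

/-- Exponential bounds for neighbourhoods of points, together with exponential tightness. -/
structure SatisfiesPointwiseLDP (μ : ℕ → Measure 𝕏) (I : 𝕏 → EReal) : Prop where
  lower : ∀ (x : 𝕏) (a : ℝ), I x < a → ∀ U ∈ 𝓝 x,
    ∀ᶠ n : ℕ in atTop, ENNReal.ofReal (Real.exp (-(n * a))) ≤ μ n U
  upper : ∀ (x : 𝕏) (a : ℝ), (a : EReal) < I x → ∃ U ∈ 𝓝 x,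
    ∀ᶠ n : ℕ in atTop, μ n U ≤ ENNReal.ofReal (Real.exp (-(n * a)))
  tight : ∀ a : ℝ, ∃ K : Set 𝕏, IsCompact K ∧
    ∀ᶠ n : ℕ in atTop, μ n Kᶜ ≤ ENNReal.ofReal (Real.exp (-(n * a)))

namespace SatisfiesPointwiseLDP

variable {μ : ℕ → Measure 𝕏} {I : 𝕏 → EReal}

/-- The neighbourhood given by the upper bound at `x` is also a neighbourhood of every `z` near `x`.
A smaller rate at `z` would force more mass on it than the upper bound allows. -/
lemma lowerSemicontinuous (h : SatisfiesPointwiseLDP μ I) : LowerSemicontinuous I := by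
  intro x y hy
  obtain ⟨a, hya, hax⟩ := EReal.lt_iff_exists_real_btwn.1 hy
  obtain ⟨U, hU, hμ⟩ := h.upper x a hax
  filter_upwards [eventually_mem_nhds_iff.2 hU] with z hz
  refine lt_of_lt_of_le hya ?_
  by_contra! hlt
  obtain ⟨b, hzb, hba⟩ := EReal.lt_iff_exists_real_btwn.1 hlt
  obtain ⟨n, hn, h1, h2⟩ := ((eventually_gt_atTop 0).and (hμ.and (h.lower z b hzb U hz))).exists
  exact absurd (h2.trans h1) (not_le.2 (exp_neg_mul_lt_exp_neg_mul hn (by exact_mod_cast hba)))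

/-- A point of low rate cannot lie outside a compact set whose complement has much smaller mass,
because that complement is an open neighbourhood of the point. -/
lemma isGoodRateFunction [T2Space 𝕏] (h : SatisfiesPointwiseLDP μ I) (hI : ∀ x, I x ≠ ⊥) :
    IsGoodRateFunction I where
  ne_bot := hI
  lsc := h.lowerSemicontinuous
  compact_sublevel a := by
    obtain ⟨K, hK, hμ⟩ := h.tight (a + 2)
    refine hK.of_isClosed_subset (h.lowerSemicontinuous.isClosed_preimage a) fun x hx => ?_
    by_contra hxK
    have hx1 : I x < ((a + 1 : ℝ) : EReal) :=
      lt_of_le_of_lt hx (by exact_mod_cast lt_add_one a)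
    obtain ⟨n, hn, h1, h2⟩ := ((eventually_gt_atTop 0).and
      (hμ.and (h.lower x (a + 1) hx1 _ (hK.isClosed.isOpen_compl.mem_nhds hxK)))).exists
    exact absurd (h2.trans h1) (not_le.2 (exp_neg_mul_lt_exp_neg_mul hn (by linarith)))

lemma satisfiesLDP (h : SatisfiesPointwiseLDP μ I) : SatisfiesLDP μ I where
  lower O hO := by
    rw [EReal.neg_le]
    refine le_iInf₂ fun x hx => ?_
    refine le_of_forall_gt_imp_ge_of_dense fun b hb => ?_
    obtain ⟨a, hxa, hab⟩ := EReal.lt_iff_exists_real_btwn.1 hb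
    refine le_trans ?_ hab.le
    rw [EReal.neg_le, ← EReal.coe_neg]
    refine le_liminf_of_le (by isBoundedDefault) ?_
    filter_upwards [eventually_gt_atTop 0, h.lower x a hxa O (hO.mem_nhds hx)] with n hn h1
    exact le_log_div_of_exp_le hn h1
  upper F hF := by
    rw [EReal.le_neg]
    refine le_of_forall_lt_imp_le_of_dense fun b hb => ?_
    obtain ⟨a, hba, ha⟩ := EReal.lt_iff_exists_real_btwn.1 hb
    -- The gap between `a` and `a'` absorbs the number of sets in the finite cover of `K ∩ F`, plus
    -- one for `Kᶜ`.
    obtain ⟨a', haa', ha'⟩ := EReal.lt_iff_exists_real_btwn.1 ha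
    refine hba.le.trans ?_
    rw [EReal.le_neg, ← EReal.coe_neg]
    obtain ⟨K, hK, hμK⟩ := h.tight a'
    have hx : ∀ x ∈ K ∩ F, ∃ U ∈ 𝓝 x,
        ∀ᶠ n : ℕ in atTop, μ n U ≤ ENNReal.ofReal (Real.exp (-(n * a'))) := fun x hx =>
      h.upper x a' (lt_of_lt_of_le ha' (iInf₂_le x hx.2))
    choose! U hU hμU using hx
    obtain ⟨t, htK, ht⟩ := (hK.inter_right hF).elim_nhds_subcover U hU
    have hcov : F ⊆ Kᶜ ∪ ⋃ x ∈ t, U x := fun x hxF => by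
      by_cases hxK : x ∈ K
      · exact Or.inr (ht ⟨hxK, hxF⟩)
      · exact Or.inl hxK
    have hall : ∀ᶠ n : ℕ in atTop, ∀ x ∈ t, μ n (U x) ≤ ENNReal.ofReal (Real.exp (-(n * a'))) :=
      (Finset.eventually_all t).2 fun x hx => hμU x (htK x hx)
    refine limsup_le_of_le (by isBoundedDefault) ?_
    filter_upwards [eventually_gt_atTop 0, hall, hμK,
      eventually_const_mul_exp_neg_le (t.card + 1) (EReal.coe_lt_coe_iff.1 haa')] with n hn h1 h2 h3
    refine log_div_le_of_le_exp hn (le_trans ?_ h3)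
    calc μ n F ≤ μ n Kᶜ + ∑ x ∈ t, μ n (U x) :=
          (measure_mono hcov).trans ((measure_union_le _ _).trans
            (add_le_add le_rfl (measure_biUnion_finset_le _ _)))
      _ ≤ ENNReal.ofReal (Real.exp (-(n * a'))) +
          ∑ x ∈ t, ENNReal.ofReal (Real.exp (-(n * a'))) := by
          gcongr with x hx
          exact h1 x hx
      _ = _ := by
          rw [Finset.sum_const, nsmul_eq_mul, ENNReal.ofReal_add (by positivity) zero_le_one,
            ENNReal.ofReal_natCast, ENNReal.ofReal_one]
          ring

end SatisfiesPointwiseLDP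

end LargeDeviations

/-! ### Product measures and Chernoff's bound. -/

section ProductMeasures

variable {W : Type*} [MeasurableSpace W] {γ : Measure W}

lemma lintegral_pi_prod {ι : Type*} [Fintype ι] [IsProbabilityMeasure γ]
    {h : ι → W → ℝ≥0∞} (hh : ∀ i, Measurable (h i)) :
    ∫⁻ z, ∏ i, h i (z i) ∂(Measure.pi fun _ : ι => γ) = ∏ i, ∫⁻ w, h i w ∂γ := by
  have hind : iIndepFun (fun i (z : ι → W) => h i (z i)) (Measure.pi fun _ : ι => γ) :=
    iIndepFun_pi fun i => (hh i).aemeasurable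
  rw [lintegral_prod_eq_prod_lintegral_of_indepFun Finset.univ _ hind fun i => by fun_prop]
  refine Finset.prod_congr rfl fun i _ => ?_
  exact (measurePreserving_eval (fun _ : ι => γ) i).lintegral_comp (hh i)

lemma pi_withDensity {ι : Type*} [Fintype ι] [IsProbabilityMeasure γ] {h : W → ℝ≥0∞}
    (hh : Measurable h) [SigmaFinite (γ.withDensity h)] :
    Measure.pi (fun _ : ι => γ.withDensity h) =
      (Measure.pi fun _ : ι => γ).withDensity fun z => ∏ i, h (z i) := by
  classical
  refine Measure.pi_eq fun s hs => ?_
  have hS : MeasurableSet (Set.univ.pi s) := MeasurableSet.univ_pi hs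
  rw [withDensity_apply _ hS, ← lintegral_indicator hS]
  have : (Set.univ.pi s).indicator (fun z : ι → W => ∏ i, h (z i)) =
      fun z => ∏ i, (s i).indicator h (z i) := by
    ext z
    by_cases hz : z ∈ Set.univ.pi s
    · rw [Set.indicator_of_mem hz]
      exact Finset.prod_congr rfl fun i _ => (Set.indicator_of_mem (hz i trivial) _).symm
    · rw [Set.indicator_of_notMem hz]
      simp only [Set.mem_pi, Set.mem_univ, true_implies, not_forall] at hz
      obtain ⟨i, hi⟩ := hz
      exact (Finset.prod_eq_zero (Finset.mem_univ i) (Set.indicator_of_notMem hi _)).symm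
  rw [this, lintegral_pi_prod fun i => hh.indicator (hs i)]
  exact Finset.prod_congr rfl fun i _ => by
    rw [lintegral_indicator (hs i), withDensity_apply _ (hs i)]

/-- Chernoff's bound for sums of independent identically distributed variables. -/
lemma pi_le_sum_le_exp_mul_pow [IsProbabilityMeasure γ] {φ : W → ℝ} (hφ : Measurable φ) (C : ℕ)
    (t : ℝ) :
    (Measure.pi fun _ : Fin C => γ) {z | t ≤ ∑ c, φ (z c)} ≤
      ENNReal.ofReal (Real.exp (-t)) * (∫⁻ w, ENNReal.ofReal (Real.exp (φ w)) ∂γ) ^ C := by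
  have hprod : (∫⁻ w, ENNReal.ofReal (Real.exp (φ w)) ∂γ) ^ C =
      ∫⁻ z, ENNReal.ofReal (Real.exp (∑ c, φ (z c))) ∂(Measure.pi fun _ : Fin C => γ) := by
    simp_rw [Real.exp_sum, ENNReal.ofReal_prod_of_nonneg fun _ _ => (Real.exp_pos _).le]
    rw [lintegral_pi_prod (h := fun _ w => ENNReal.ofReal (Real.exp (φ w))) fun i => by fun_prop]
    simp
  rw [hprod, ← lintegral_const_mul _ (by fun_prop)]
  have hS : MeasurableSet {z : Fin C → W | t ≤ ∑ c, φ (z c)} :=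
    measurableSet_le measurable_const (by fun_prop)
  rw [← lintegral_indicator_one hS]
  refine lintegral_mono fun z => ?_
  by_cases hz : t ≤ ∑ c, φ (z c)
  · rw [Set.indicator_of_mem (by exact hz), ← ENNReal.ofReal_mul (Real.exp_pos _).le, ← Real.exp_add]
    simpa using hz
  · rw [Set.indicator_of_notMem (by exact hz)]
    exact zero_le

end ProductMeasures

/-! ### Exponential moments via Hölder's inequality. -/

section ExponentialMoments

variable {W : Type*} [MeasurableSpace W] {γ : Measure W}

/-- Hölder's inequality with exponents `1 / t` and `1 / (1 - t)`. It separates a main exponent from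
a perturbation. -/
lemma lintegral_exp_add_le {φ ψ : W → ℝ} (hφ : Measurable φ) (hψ : Measurable ψ) {t : ℝ}
    (h0 : 0 < t) (h1 : t < 1) :
    ∫⁻ w, ENNReal.ofReal (Real.exp (t * φ w + (1 - t) * ψ w)) ∂γ ≤
      (∫⁻ w, ENNReal.ofReal (Real.exp (φ w)) ∂γ) ^ t *
        (∫⁻ w, ENNReal.ofReal (Real.exp (ψ w)) ∂γ) ^ (1 - t) := by
  refine le_trans (le_of_eq ?_) (ENNReal.lintegral_mul_norm_pow_le (by fun_prop) (by fun_prop)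
    h0.le (sub_pos.2 h1).le (add_sub_cancel t 1))
  refine lintegral_congr fun w => ?_
  rw [Real.exp_add, ENNReal.ofReal_mul (Real.exp_pos _).le,
    ENNReal.ofReal_rpow_of_pos (Real.exp_pos _), ENNReal.ofReal_rpow_of_pos (Real.exp_pos _),
    ← Real.exp_mul, ← Real.exp_mul, mul_comm t, mul_comm (1 - t)]

/-- If some exponential moment of `q ≥ 0` is finite, then its small exponential moments are close
to one. -/
lemma exists_lintegral_exp_mul_le [IsProbabilityMeasure γ] {q : W → ℝ} (hq : Measurable q)
    {t₀ : ℝ} (ht₀ : 0 < t₀)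
    (hfin : ∫⁻ w, ENNReal.ofReal (Real.exp (t₀ * q w)) ∂γ ≠ ∞) {η : ℝ} (hη : 0 < η) :
    ∃ t : ℝ, 0 < t ∧ ∫⁻ w, ENNReal.ofReal (Real.exp (t * q w)) ∂γ ≤ ENNReal.ofReal (Real.exp η) := by
  set A := ∫⁻ w, ENNReal.ofReal (Real.exp (t₀ * q w)) ∂γ with hA
  obtain ⟨B, hB0, hAB⟩ : ∃ B : ℝ, 0 < B ∧ A ≤ ENNReal.ofReal (Real.exp B) := by
    refine ⟨max 1 (Real.log A.toReal), lt_of_lt_of_le one_pos (le_max_left _ _), ?_⟩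
    refine (ENNReal.ofReal_toReal hfin).symm.le.trans (ENNReal.ofReal_le_ofReal ?_)
    rcases (ENNReal.toReal_nonneg (a := A)).eq_or_lt with h | h
    · rw [← h]; positivity
    · exact (Real.log_le_iff_le_exp h).1 (le_max_right _ _)
  -- Hölder against the constant one bounds the moment at `s * t₀` by `A ^ s`, at most `exp (B *
  -- s)`; the cap `1 / 2` keeps `s < 1`.
  set s := min (1 / 2) (η / B) with hs
  have hs0 : 0 < s := lt_min (by norm_num) (div_pos hη hB0)
  have hs1 : s < 1 := lt_of_le_of_lt (min_le_left (1 / 2) (η / B)) (by norm_num)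
  refine ⟨s * t₀, by positivity, ?_⟩
  have h := lintegral_exp_add_le (γ := γ) (φ := fun w => t₀ * q w) (ψ := fun _ => 0)
    (by fun_prop) (by fun_prop) hs0 hs1
  simp only [mul_zero, add_zero, Real.exp_zero, ENNReal.ofReal_one, lintegral_const, measure_univ,
    mul_one, ENNReal.one_rpow, ← mul_assoc] at h
  refine h.trans ?_
  calc A ^ s ≤ ENNReal.ofReal (Real.exp B) ^ s := by gcongr
    _ = ENNReal.ofReal (Real.exp (B * s)) := by
      rw [ENNReal.ofReal_rpow_of_pos (Real.exp_pos _), ← Real.exp_mul]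
    _ ≤ _ := by
      refine ENNReal.ofReal_le_ofReal (Real.exp_le_exp.2 ?_)
      calc B * s ≤ B * (η / B) := by gcongr; exact min_le_right (1 / 2) (η / B)
        _ = η := by field_simp

end ExponentialMoments

/-! ### Weak law of large numbers and truncation. -/

section CramerLowerBound

open scoped RealInnerProductSpace

variable {W : Type*} [MeasurableSpace W]
variable {E : Type*} [NormedAddCommGroup E] [InnerProductSpace ℝ E] [FiniteDimensional ℝ E]
  [MeasurableSpace E] [BorelSpace E]

/-- Chebyshev's inequality: the variance of the sum is linear in `n`, the squared threshold
quadratic. -/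
lemma tendsto_pi_abs_mean_sub_ge {ρ : Measure W} [IsProbabilityMeasure ρ] {Y : W → ℝ}
    (hY : MemLp Y 2 ρ) {r : ℝ} (hr : 0 < r) :
    Tendsto (fun n : ℕ => (Measure.pi fun _ : Fin n => ρ)
      {z | r ≤ |(n : ℝ)⁻¹ * ∑ c, Y (z c) - ∫ w, Y w ∂ρ|}) atTop (𝓝 0) := by
  have hlim : Tendsto (fun n : ℕ => ENNReal.ofReal (Var[Y; ρ] / r ^ 2 / n)) atTop (𝓝 0) := by
    rw [← ENNReal.ofReal_zero]
    exact ENNReal.tendsto_ofReal (tendsto_const_div_atTop_nhds_zero_nat _)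
  refine tendsto_of_tendsto_of_tendsto_of_le_of_le' tendsto_const_nhds hlim
    (Eventually.of_forall fun n => zero_le) ?_
  filter_upwards [eventually_gt_atTop 0] with n hn
  have hn' : (0 : ℝ) < n := by exact_mod_cast hn
  set π := Measure.pi fun _ : Fin n => ρ
  have hmem : ∀ c : Fin n, MemLp (fun z : Fin n → W => Y (z c)) 2 π := fun c =>
    hY.comp_measurePreserving (measurePreserving_eval (fun _ : Fin n => ρ) c)
  have hsum : MemLp (∑ c : Fin n, fun z : Fin n → W => Y (z c)) 2 π :=
    memLp_finsetSum' _ fun c _ => hmem c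
  have hvar : Var[∑ c : Fin n, fun z : Fin n → W => Y (z c); π] = n * Var[Y; ρ] := by
    rw [variance_sum_pi fun _ => hY]; simp
  have hmean : ∫ z, (∑ c : Fin n, fun z : Fin n → W => Y (z c)) z ∂π = n * ∫ w, Y w ∂ρ := by
    simp only [Finset.sum_apply]
    rw [integral_finsetSum _ fun c _ => (hmem c).integrable one_le_two]
    have heval : ∀ c : Fin n, ∫ z, Y (z c) ∂π = ∫ w, Y w ∂ρ := fun c =>
      integral_comp_eval (μ := fun _ : Fin n => ρ) hY.aestronglyMeasurable
    simp [heval]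
  have h := meas_ge_le_variance_div_sq hsum (c := n * r) (by positivity)
  rw [hvar, hmean] at h
  refine (measure_mono fun z hz => ?_).trans (h.trans (le_of_eq ?_))
  · simp only [Set.mem_ofPred_eq, Finset.sum_apply] at hz ⊢
    calc (n : ℝ) * r ≤ n * |(n : ℝ)⁻¹ * ∑ c, Y (z c) - ∫ w, Y w ∂ρ| := by gcongr
      _ = |(n : ℝ) * ((n : ℝ)⁻¹ * ∑ c, Y (z c) - ∫ w, Y w ∂ρ)| := by
        rw [abs_mul, abs_of_pos hn']
      _ = _ := by congr 1; field_simp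
  · congr 1; field_simp

/-- The scalar weak law is applied in each coordinate of an orthonormal basis. Probability one half
suffices, since constants are invisible on the exponential scale. -/
lemma eventually_half_le_pi_norm_mean_sub_lt {ρ : Measure W} [IsProbabilityMeasure ρ] {f : W → E}
    (hf : Measurable f) {M : ℝ} (hM : ∀ᵐ w ∂ρ, ‖f w‖ ≤ M) {r : ℝ} (hr : 0 < r) :
    ∀ᶠ n : ℕ in atTop, 1 / 2 ≤ (Measure.pi fun _ : Fin n => ρ)
      {z | ‖(n : ℝ)⁻¹ • ∑ c, f (z c) - ∫ w, f w ∂ρ‖ < r} := by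
  let b := stdOrthonormalBasis ℝ E
  set d := Module.finrank ℝ E
  set m := ∫ w, f w ∂ρ with hm
  have hint : Integrable f ρ := Integrable.of_bound hf.aestronglyMeasurable M hM
  have hmem : ∀ i, MemLp (fun w => ⟪b i, f w⟫) 2 ρ := fun i => by
    refine MemLp.of_bound (by fun_prop) M ?_
    filter_upwards [hM] with w hw
    refine (norm_inner_le_norm _ _).trans ?_
    simpa using hw
  set s : ℝ := r / (d + 1) with hs
  have hs0 : 0 < s := by positivity
  have hlim : Tendsto (fun n : ℕ => ∑ i, (Measure.pi fun _ : Fin n => ρ)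
      {z | s ≤ |(n : ℝ)⁻¹ * ∑ c, ⟪b i, f (z c)⟫ - ∫ w, ⟪b i, f w⟫ ∂ρ|}) atTop (𝓝 0) := by
    simpa using tendsto_finsetSum Finset.univ fun i _ => tendsto_pi_abs_mean_sub_ge (hmem i) hs0
  filter_upwards [hlim.eventually_le_const (show (0 : ℝ≥0∞) < 1 / 2 by simp)] with n hn
  set S := {z : Fin n → W | ‖(n : ℝ)⁻¹ • ∑ c, f (z c) - m‖ < r} with hS
  have hSmeas : MeasurableSet S := measurableSet_lt (by fun_prop) measurable_const
  have hcompl : (Measure.pi fun _ : Fin n => ρ) Sᶜ ≤ 1 / 2 := by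
    refine (measure_mono fun z hz => ?_).trans ((measure_iUnion_fintype_le _ _).trans hn)
    by_contra hcon
    simp only [Set.mem_iUnion, Set.mem_ofPred_eq, not_exists, not_le] at hcon
    refine hz ?_
    set x := (n : ℝ)⁻¹ • ∑ c, f (z c) - m with hx
    have hxi : ∀ i, |⟪b i, x⟫| < s := fun i => by
      have := hcon i
      rwa [integral_inner hint, ← inner_sum, ← real_inner_smul_right, ← inner_sub_right] at this
    change ‖x‖ < r
    calc ‖x‖ = ‖∑ i, ⟪b i, x⟫ • b i‖ := by rw [b.sum_repr' x]
      _ ≤ ∑ i, ‖⟪b i, x⟫ • b i‖ := norm_sum_le _ _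
      _ ≤ ∑ i : Fin d, s := Finset.sum_le_sum fun i _ => by
          rw [norm_smul, b.norm_eq_one, mul_one]; exact (hxi i).le
      _ = d * s := by simp
      _ < r := by
          rw [hs, mul_div_assoc', div_lt_iff₀ (by positivity)]
          nlinarith
  rw [prob_compl_eq_one_sub hSmeas, tsub_le_iff_right] at hcompl
  have h2 : (1 / 2 : ℝ≥0∞) + 1 / 2 ≤ 1 / 2 + (Measure.pi fun _ : Fin n => ρ) S := by
    rwa [ENNReal.add_halves]
  exact (ENNReal.add_le_add_iff_left (by simp)).1 h2

lemma exists_half_le_measure_norm_le {F : Type*} [NormedAddCommGroup F] (γ : Measure W)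
    [IsProbabilityMeasure γ] (f : W → F) :
    ∃ M : ℕ, 1 / 2 ≤ γ {w | ‖f w‖ ≤ M} := by
  have hmono : Monotone fun M : ℕ => {w | ‖f w‖ ≤ M} := fun a b hab w hw => by
    rw [Set.mem_ofPred_eq] at hw ⊢
    exact hw.trans (by exact_mod_cast hab)
  have hU : ⋃ M : ℕ, {w | ‖f w‖ ≤ M} = Set.univ := Set.eq_univ_of_forall fun w =>
    Set.mem_iUnion.2 (exists_nat_ge ‖f w‖)
  have h := tendsto_measure_iUnion_atTop (μ := γ) hmono
  rw [hU, measure_univ] at h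
  exact (h.eventually_const_le (show (1 / 2 : ℝ≥0∞) < 1 by simp)).exists

/-- Truncation of the moment generating function: a quadratic correction makes the lower bound
survive the restriction to the set where `f` is bounded by a large constant. -/
lemma exists_exp_le_setLIntegral_exp_inner {γ : Measure W} [IsProbabilityMeasure γ] {f : W → E}
    (hf : Measurable f) {y : E} {c : ℝ}
    (H : ∀ θ : E, ENNReal.ofReal (Real.exp (⟪θ, y⟫ - c)) ≤
      ∫⁻ w, ENNReal.ofReal (Real.exp ⟪θ, f w⟫) ∂γ) {c' δ : ℝ} (hc : c < c') (hδ : 0 < δ) :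
    ∃ M : ℕ, 1 / 2 ≤ γ {w | ‖f w‖ ≤ M} ∧ ∀ θ : E,
      ENNReal.ofReal (Real.exp (⟪θ, y⟫ - c' - δ * ‖θ‖ ^ 2)) ≤
        ∫⁻ w in {w | ‖f w‖ ≤ M}, ENNReal.ofReal (Real.exp ⟪θ, f w⟫) ∂γ := by
  obtain ⟨M₁, hM₁⟩ := exists_half_le_measure_norm_le γ f
  have hmono : ∀ {a b : ℕ}, a ≤ b → {w | ‖f w‖ ≤ a} ⊆ {w | ‖f w‖ ≤ b} := fun hab w hw => by
    rw [Set.mem_ofPred_eq] at hw ⊢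
    exact hw.trans (by exact_mod_cast hab)
  have hmeas : ∀ k : ℕ, MeasurableSet {w | ‖f w‖ ≤ k} := fun k =>
    measurableSet_le (by fun_prop) measurable_const
  -- If every truncation level fails, each has a violating `θ k`. The quadratic term keeps these
  -- bounded, and at a limit point Fatou's lemma contradicts `H`, as `c < c'`.
  by_contra! hcon
  have hcon' : ∀ k : ℕ, ∃ θ : E,
      ∫⁻ w in {w | ‖f w‖ ≤ (M₁ + k : ℕ)}, ENNReal.ofReal (Real.exp ⟪θ, f w⟫) ∂γ <
        ENNReal.ofReal (Real.exp (⟪θ, y⟫ - c' - δ * ‖θ‖ ^ 2)) := fun k =>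
    hcon (M₁ + k) (hM₁.trans (measure_mono (hmono (Nat.le_add_right _ _))))
  choose θ hθ using hcon'
  -- On `‖f‖ ≤ M₁`, of mass at least one half, the integral is at least `exp (-‖θ‖ * M₁ - 1)`. A
  -- violation with `‖θ‖ > 1` then forces `δ * ‖θ‖ < ‖y‖ + M₁ + |c'| + 1`.
  set R : ℝ := max 1 ((‖y‖ + M₁ + |c'| + 1) / δ) with hR
  have hbdd : ∀ k, θ k ∈ Metric.closedBall (0 : E) R := fun k => by
    rw [mem_closedBall_zero_iff]
    by_contra! hlt
    have h1 : 1 < ‖θ k‖ := lt_of_le_of_lt (le_max_left _ _) hlt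
    have h2 : ‖y‖ + M₁ + |c'| + 1 < ‖θ k‖ * δ :=
      (div_lt_iff₀ hδ).1 (lt_of_le_of_lt (le_max_right _ _) hlt)
    have h3 : ENNReal.ofReal (Real.exp (-(‖θ k‖ * M₁)) * (1 / 2)) ≤
        ∫⁻ w in {w | ‖f w‖ ≤ (M₁ + k : ℕ)}, ENNReal.ofReal (Real.exp ⟪θ k, f w⟫) ∂γ := by
      calc ENNReal.ofReal (Real.exp (-(‖θ k‖ * M₁)) * (1 / 2))
          ≤ ENNReal.ofReal (Real.exp (-(‖θ k‖ * M₁))) * γ {w | ‖f w‖ ≤ M₁} := by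
            rw [ENNReal.ofReal_mul (Real.exp_pos _).le]
            gcongr
            refine le_trans (le_of_eq ?_) hM₁
            rw [ENNReal.ofReal_div_of_pos two_pos]; simp
        _ = ∫⁻ w in {w | ‖f w‖ ≤ M₁}, ENNReal.ofReal (Real.exp (-(‖θ k‖ * M₁))) ∂γ := by
            rw [setLIntegral_const]
        _ ≤ ∫⁻ w in {w | ‖f w‖ ≤ M₁}, ENNReal.ofReal (Real.exp ⟪θ k, f w⟫) ∂γ := by
            refine setLIntegral_mono' (hmeas _) fun w hw => ?_
            refine ENNReal.ofReal_le_ofReal (Real.exp_le_exp.2 ?_)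
            have := neg_le_of_abs_le (abs_real_inner_le_norm (θ k) (f w))
            refine le_trans (neg_le_neg ?_) this
            exact mul_le_mul_of_nonneg_left hw (norm_nonneg _)
        _ ≤ _ := lintegral_mono_set (hmono (Nat.le_add_right _ _))
    have h4 := (ENNReal.ofReal_lt_ofReal_iff (Real.exp_pos _)).1 (h3.trans_lt (hθ k))
    have h5 : Real.exp (-1) ≤ 1 / 2 := by
      rw [Real.exp_neg, inv_eq_one_div]
      exact one_div_le_one_div_of_le two_pos (by linarith [Real.add_one_le_exp 1])
    have h6 : Real.exp (-(‖θ k‖ * M₁) + -1) < Real.exp (⟪θ k, y⟫ - c' - δ * ‖θ k‖ ^ 2) := by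
      rw [Real.exp_add]
      exact (mul_le_mul_of_nonneg_left h5 (Real.exp_pos _).le).trans_lt h4
    rw [Real.exp_lt_exp] at h6
    have h7 := real_inner_le_norm (θ k) y
    have h8 := neg_abs_le c'
    have h9 : (|c'| + 1) * 1 ≤ (|c'| + 1) * ‖θ k‖ := by gcongr
    nlinarith
  obtain ⟨θ', -, φ, hφ, hlim⟩ := tendsto_subseq_of_bounded Metric.isBounded_closedBall hbdd
  have hupper : Tendsto (fun k => ENNReal.ofReal (Real.exp
      (⟪θ (φ k), y⟫ - c' - δ * ‖θ (φ k)‖ ^ 2))) atTop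
      (𝓝 (ENNReal.ofReal (Real.exp (⟪θ', y⟫ - c' - δ * ‖θ'‖ ^ 2)))) := by
    have hc : Continuous fun x : E => ENNReal.ofReal (Real.exp (⟪x, y⟫ - c' - δ * ‖x‖ ^ 2)) :=
      ENNReal.continuous_ofReal.comp (by fun_prop)
    exact (hc.tendsto θ').comp hlim
  have hfatou : ∫⁻ w, ENNReal.ofReal (Real.exp ⟪θ', f w⟫) ∂γ ≤
      liminf (fun k => ∫⁻ w, ({w | ‖f w‖ ≤ (M₁ + φ k : ℕ)}.indicator
        fun w => ENNReal.ofReal (Real.exp ⟪θ (φ k), f w⟫)) w ∂γ) atTop := by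
    refine le_trans (le_of_eq (lintegral_congr fun w => ?_))
      (lintegral_liminf_le fun k => Measurable.indicator (by fun_prop) (hmeas _))
    have hc : Continuous fun x : E => ENNReal.ofReal (Real.exp ⟪x, f w⟫) :=
      ENNReal.continuous_ofReal.comp (by fun_prop)
    have ht := (hc.tendsto θ').comp hlim
    refine (Tendsto.liminf_eq (ht.congr' ?_)).symm
    obtain ⟨k₀, hk₀⟩ := exists_nat_ge ‖f w‖
    filter_upwards [eventually_ge_atTop k₀] with k hk
    rw [Set.indicator_of_mem]
    · rfl
    · refine hk₀.trans ?_
      have : k₀ ≤ M₁ + φ k := (hk.trans (hφ.id_le k)).trans (Nat.le_add_left _ _)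
      exact_mod_cast this
  have hle : ∫⁻ w, ENNReal.ofReal (Real.exp ⟪θ', f w⟫) ∂γ ≤
      ENNReal.ofReal (Real.exp (⟪θ', y⟫ - c' - δ * ‖θ'‖ ^ 2)) := by
    rw [← hupper.liminf_eq]
    refine hfatou.trans (liminf_le_liminf (Eventually.of_forall fun k => ?_))
    rw [lintegral_indicator (hmeas _)]
    exact (hθ (φ k)).le
  have hfin := (H θ').trans hle
  rw [ENNReal.ofReal_le_ofReal_iff (Real.exp_pos _).le, Real.exp_le_exp] at hfin
  have : 0 ≤ δ * ‖θ'‖ ^ 2 := by positivity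
  linarith

end CramerLowerBound

/-! ### Exponential tilting and Cramér's lower bound. -/

section CramerLowerBound

open scoped RealInnerProductSpace

variable {W : Type*} [MeasurableSpace W]
variable {E : Type*} [NormedAddCommGroup E] [InnerProductSpace ℝ E] [FiniteDimensional ℝ E]
  [MeasurableSpace E] [BorelSpace E]

lemma integrable_exp_inner_of_norm_le {κ : Measure W} [IsFiniteMeasure κ] {f : W → E}
    (hf : Measurable f) {M : ℝ} (hM : ∀ᵐ w ∂κ, ‖f w‖ ≤ M) (θ : E) :
    Integrable (fun w => Real.exp ⟪θ, f w⟫) κ := by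
  refine Integrable.of_bound (by fun_prop) (Real.exp (‖θ‖ * M)) ?_
  filter_upwards [hM] with w hw
  rw [Real.norm_eq_abs, Real.abs_exp, Real.exp_le_exp]
  exact (real_inner_le_norm _ _).trans (mul_le_mul_of_nonneg_left hw (norm_nonneg _))

lemma continuous_integral_exp_inner_of_norm_le {κ : Measure W} [IsFiniteMeasure κ] {f : W → E}
    (hf : Measurable f) {M : ℝ} (hM : ∀ᵐ w ∂κ, ‖f w‖ ≤ M) :
    Continuous fun θ : E => ∫ w, Real.exp ⟪θ, f w⟫ ∂κ := by
  refine continuous_iff_continuousAt.2 fun θ => ?_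
  refine continuousAt_of_dominated (bound := fun _ => Real.exp ((‖θ‖ + 1) * M))
    (Eventually.of_forall fun _ => by fun_prop) ?_ (integrable_const _)
    (Eventually.of_forall fun w => by fun_prop)
  have hlt : ∀ᶠ x : E in 𝓝 θ, ‖x‖ < ‖θ‖ + 1 :=
    continuous_norm.continuousAt.eventually_lt continuousAt_const (lt_add_one _)
  filter_upwards [hlt] with x hx
  filter_upwards [hM] with w hw
  rw [Real.norm_eq_abs, Real.abs_exp, Real.exp_le_exp]
  exact (real_inner_le_norm _ _).trans (mul_le_mul hx.le hw (norm_nonneg _) (by positivity))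

/-- The first order condition for the minimum of `θ ↦ e^{δ‖θ‖² - ⟪θ, y⟫} ∫ e^{⟪θ, f⟫}`: the mean of
`f` under the tilted measure. -/
lemma integral_tilted_of_forall_le {κ : Measure W} [IsFiniteMeasure κ] [NeZero κ] {f : W → E}
    (hf : Measurable f) {M : ℝ} (hM : ∀ᵐ w ∂κ, ‖f w‖ ≤ M) {y θ : E} {δ : ℝ}
    (hmin : ∀ x : E, Real.exp (δ * ‖θ‖ ^ 2 - ⟪θ, y⟫) * ∫ w, Real.exp ⟪θ, f w⟫ ∂κ ≤
      Real.exp (δ * ‖x‖ ^ 2 - ⟪x, y⟫) * ∫ w, Real.exp ⟪x, f w⟫ ∂κ) :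
    ∫ w, f w ∂(κ.tilted fun w => ⟪θ, f w⟫) = y - (2 * δ) • θ := by
  set ρ := κ.tilted fun w => ⟪θ, f w⟫ with hρ
  have hint := integrable_exp_inner_of_norm_le hf hM θ
  have hpos : 0 < ∫ w, Real.exp ⟪θ, f w⟫ ∂κ := integral_exp_pos hint
  have : IsProbabilityMeasure ρ := isProbabilityMeasure_tilted hint
  have hMρ : ∀ᵐ w ∂ρ, ‖f w‖ ≤ M := (tilted_absolutelyContinuous κ _).ae_le hM
  have hfint : Integrable f ρ := Integrable.of_bound hf.aestronglyMeasurable M hMρ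
  refine ext_inner_left ℝ fun v => ?_
  rw [← integral_inner hfint]
  have hset : integrableExpSet (fun w => ⟪v, f w⟫) ρ = Set.univ := by
    refine Set.eq_univ_of_forall fun t => ?_
    refine integrable_exp_mul_of_mem_Icc (a := -(‖v‖ * M)) (b := ‖v‖ * M) (by fun_prop) ?_
    filter_upwards [hMρ] with w hw
    rw [Set.mem_Icc, ← abs_le]
    exact (abs_real_inner_le_norm _ _).trans (mul_le_mul_of_nonneg_left hw (norm_nonneg _))
  have hmgf : ∀ t : ℝ, mgf (fun w => ⟪v, f w⟫) ρ t =
      (∫ w, Real.exp ⟪θ + t • v, f w⟫ ∂κ) / ∫ w, Real.exp ⟪θ, f w⟫ ∂κ := fun t => by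
    rw [mgf, hρ, integral_exp_tilted]
    simp only [Pi.add_apply, inner_add_left, real_inner_smul_left]
  have hd1 : HasDerivAt (mgf (fun w => ⟪v, f w⟫) ρ) (∫ w, ⟪v, f w⟫ ∂ρ) 0 := by
    have := hasDerivAt_mgf (X := fun w => ⟪v, f w⟫) (μ := ρ) (t := 0) (by simp [hset])
    simpa using this
  set g : ℝ → ℝ := fun t => Real.exp (δ * ‖θ + t • v‖ ^ 2 - ⟪θ + t • v, y⟫) with hg
  have hgeq : g = fun t : ℝ => Real.exp (δ * (‖θ‖ ^ 2 + 2 * t * ⟪θ, v⟫ + t ^ 2 * ‖v‖ ^ 2) -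
      (⟪θ, y⟫ + t * ⟪v, y⟫)) := by
    ext t
    rw [hg]
    simp only [norm_add_sq_real, inner_add_left, real_inner_smul_left, real_inner_smul_right,
      norm_smul, mul_pow, Real.norm_eq_abs, sq_abs]
    congr 2; ring
  have hd2 : HasDerivAt g (g 0 * (2 * δ * ⟪θ, v⟫ - ⟪v, y⟫)) 0 := by
    have h1 : HasDerivAt (fun t : ℝ => δ * (‖θ‖ ^ 2 + 2 * t * ⟪θ, v⟫ + t ^ 2 * ‖v‖ ^ 2) -
      (⟪θ, y⟫ + t * ⟪v, y⟫)) (2 * δ * ⟪θ, v⟫ - ⟪v, y⟫) 0 := by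
      have e1 := ((((hasDerivAt_id (0 : ℝ)).const_mul 2).mul_const ⟪θ, v⟫).const_add (‖θ‖ ^ 2)).add
        (((hasDerivAt_id (0 : ℝ)).pow 2).mul_const (‖v‖ ^ 2))
      have e2 := (e1.const_mul δ).sub
        (((hasDerivAt_id (0 : ℝ)).mul_const ⟪v, y⟫).const_add ⟪θ, y⟫)
      exact e2.congr_deriv (by norm_num; ring)
    have := h1.exp
    rw [hgeq]
    exact this
  -- By `hmgf`, this product is the objective along the line `θ + t • v`, divided by a positive
  -- constant. Its vanishing derivative identifies the mean in direction `v`.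
  have hmin' : IsLocalMin (fun t => g t * mgf (fun w => ⟪v, f w⟫) ρ t) 0 := by
    refine Eventually.of_forall fun t => ?_
    simp only [hmgf, hg, zero_smul, add_zero]
    rw [mul_div_assoc', mul_div_assoc']
    exact div_le_div_of_nonneg_right (hmin _) hpos.le
  have hzero := hmin'.hasDerivAt_eq_zero (hd2.mul hd1)
  rw [mgf_zero, mul_one, ← mul_add] at hzero
  have hg0 : g 0 ≠ 0 := (Real.exp_pos _).ne'
  have := (mul_eq_zero.1 hzero).resolve_left hg0
  rw [inner_sub_right, real_inner_smul_right, real_inner_comm θ v]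
  linarith

/-- Without the penalty, a minimising tilt need not exist. With it, a minimiser exists and the
tilted mean misses `y` only by `2 * δ * ‖θ‖`. The last bound, on `⟪θ, m⟫ - b` at the tilted mean
`m`, is the cost per sample of the change of measure. -/
lemma exists_withDensity_mean_close {γ : Measure W} [IsProbabilityMeasure γ] {f : W → E}
    (hf : Measurable f) {y : E} {c : ℝ}
    (H : ∀ θ : E, ENNReal.ofReal (Real.exp (⟪θ, y⟫ - c)) ≤
      ∫⁻ w, ENNReal.ofReal (Real.exp ⟪θ, f w⟫) ∂γ) {c' r : ℝ} (hc : c < c') (hr : 0 < r) :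
    ∃ (h : W → ℝ≥0∞) (θ : E) (b M : ℝ), Measurable h ∧ IsProbabilityMeasure (γ.withDensity h) ∧
      (∀ w, h w ≤ ENNReal.ofReal (Real.exp (⟪θ, f w⟫ - b))) ∧
      (∀ᵐ w ∂(γ.withDensity h), ‖f w‖ ≤ M) ∧
      ‖∫ w, f w ∂(γ.withDensity h) - y‖ < r ∧ ⟪θ, ∫ w, f w ∂(γ.withDensity h)⟫ - b ≤ c' := by
  have hc0 : 0 ≤ c := by
    have := H 0
    simp only [inner_zero_left, Real.exp_zero, ENNReal.ofReal_one, lintegral_const, measure_univ,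
      mul_one, ENNReal.ofReal_le_one, Real.exp_le_one_iff] at this
    linarith
  have hc'0 : 0 < c' := lt_of_le_of_lt hc0 hc
  -- Comparing the minimum with the value at zero gives `δ / 2 * ‖θ‖ ^ 2 ≤ c'`, so `(2 * δ * ‖θ‖) ^
  -- 2 ≤ 8 * δ * c' = r ^ 2 / 2`.
  set δ : ℝ := r ^ 2 / (16 * c') with hδ
  have hδ0 : 0 < δ := by positivity
  -- Only half of the penalty is spent on truncation; the other half makes the objective `G`
  -- coercive.
  obtain ⟨M, hM1, hM⟩ := exists_exp_le_setLIntegral_exp_inner hf H hc (half_pos hδ0)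
  set A := {w | ‖f w‖ ≤ M} with hA
  have hAm : MeasurableSet A := measurableSet_le (by fun_prop) measurable_const
  set κ := γ.restrict A with hκ
  have hκne : NeZero κ := ⟨fun h0 => by
    rw [hκ, Measure.restrict_eq_zero] at h0
    rw [h0] at hM1
    simp at hM1⟩
  have hfM : ∀ᵐ w ∂κ, ‖f w‖ ≤ M := ae_restrict_mem hAm
  have hint := fun θ : E => integrable_exp_inner_of_norm_le hf hfM θ
  have hM' : ∀ θ : E, Real.exp (⟪θ, y⟫ - c' - δ / 2 * ‖θ‖ ^ 2) ≤ ∫ w, Real.exp ⟪θ, f w⟫ ∂κ :=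
    fun θ => by
    have := hM θ
    rw [← ofReal_integral_eq_lintegral_ofReal (hint θ)
      (Eventually.of_forall fun w => (Real.exp_pos _).le),
      ENNReal.ofReal_le_ofReal_iff (integral_nonneg fun w => (Real.exp_pos _).le)] at this
    exact this
  set G : E → ℝ := fun θ => Real.exp (δ * ‖θ‖ ^ 2 - ⟪θ, y⟫) * ∫ w, Real.exp ⟪θ, f w⟫ ∂κ with hG
  have hGlow : ∀ θ, Real.exp (δ / 2 * ‖θ‖ ^ 2 - c') ≤ G θ := fun θ => by
    calc Real.exp (δ / 2 * ‖θ‖ ^ 2 - c')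
        = Real.exp (δ * ‖θ‖ ^ 2 - ⟪θ, y⟫) * Real.exp (⟪θ, y⟫ - c' - δ / 2 * ‖θ‖ ^ 2) := by
          rw [← Real.exp_add]; ring_nf
      _ ≤ G θ := mul_le_mul_of_nonneg_left (hM' θ) (Real.exp_pos _).le
  have hGcont : Continuous G := Continuous.mul (by fun_prop)
    (continuous_integral_exp_inner_of_norm_le hf hfM)
  have hGlim : Tendsto G (cocompact E) atTop := by
    refine tendsto_atTop_mono hGlow (Real.tendsto_exp_atTop.comp ?_)
    refine tendsto_atTop_add_const_right _ _ (Tendsto.const_mul_atTop (half_pos hδ0) ?_)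
    exact (tendsto_pow_atTop two_ne_zero).comp (tendsto_norm_cocompact_atTop (E := E))
  obtain ⟨θ, hθ⟩ := hGcont.exists_forall_le hGlim
  have hmean := integral_tilted_of_forall_le hf hfM hθ
  set Φ := ∫ w, Real.exp ⟪θ, f w⟫ ∂κ with hΦ
  have hΦ0 : 0 < Φ := integral_exp_pos (hint θ)
  have hG0 : G 0 ≤ 1 := by
    simp only [hG, norm_zero, inner_zero_left, Real.exp_zero, integral_const, smul_eq_mul]
    simp only [ne_eq, OfNat.ofNat_ne_zero, not_false_eq_true, zero_pow, mul_zero, sub_zero,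
      Real.exp_zero, mul_one, one_mul]
    rw [hκ, measureReal_restrict_apply_univ]
    exact measureReal_le_one
  have hθbound : δ / 2 * ‖θ‖ ^ 2 ≤ c' := by
    have := ((hGlow θ).trans (hθ 0)).trans hG0
    rw [Real.exp_le_one_iff] at this
    linarith
  set h : W → ℝ≥0∞ := A.indicator fun w => ENNReal.ofReal (Real.exp ⟪θ, f w⟫ / Φ) with hh
  have hρ : γ.withDensity h = κ.tilted fun w => ⟪θ, f w⟫ := withDensity_indicator hAm _
  refine ⟨h, θ, Real.log Φ, M, Measurable.indicator (by fun_prop) hAm, ?_, fun w => ?_, ?_, ?_, ?_⟩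
  · rw [hρ]; exact isProbabilityMeasure_tilted (hint θ)
  · rw [Real.exp_sub, Real.exp_log hΦ0]
    exact Set.indicator_le_self _ _ w
  · rw [hρ]; exact (tilted_absolutelyContinuous κ _).ae_le hfM
  · rw [hρ, hmean, sub_sub_cancel_left, norm_neg, norm_smul, Real.norm_eq_abs,
      abs_of_pos (by positivity)]
    refine lt_of_pow_lt_pow_left₀ 2 hr.le ?_
    have h1 : δ * c' * 16 = r ^ 2 := by rw [hδ]; field_simp
    have h2 : (2 * δ * ‖θ‖) ^ 2 = 8 * δ * (δ / 2 * ‖θ‖ ^ 2) := by ring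
    rw [h2]
    have h3 : 8 * δ * (δ / 2 * ‖θ‖ ^ 2) ≤ 8 * δ * c' := by gcongr
    have h4 : 0 < r ^ 2 := by positivity
    linarith
  · rw [hρ, hmean, inner_sub_right, real_inner_smul_right, real_inner_self_eq_norm_sq]
    have h1 : ⟪θ, y⟫ - c' - δ / 2 * ‖θ‖ ^ 2 ≤ Real.log Φ := by
      rw [Real.le_log_iff_exp_le hΦ0]; exact hM' θ
    have h2 : 0 ≤ δ * ‖θ‖ ^ 2 := by positivity
    linarith

/-- **Cramér's lower bound** in finite dimension, without any moment assumption. -/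
theorem eventually_exp_neg_le_pi_norm_mean_sub_lt {γ : Measure W} [IsProbabilityMeasure γ]
    {f : W → E} (hf : Measurable f) {y : E} {c : ℝ}
    (H : ∀ θ : E, ENNReal.ofReal (Real.exp (⟪θ, y⟫ - c)) ≤
      ∫⁻ w, ENNReal.ofReal (Real.exp ⟪θ, f w⟫) ∂γ) {c' r : ℝ} (hc : c < c') (hr : 0 < r) :
    ∀ᶠ n : ℕ in atTop, ENNReal.ofReal (Real.exp (-(n * c'))) ≤
      (Measure.pi fun _ : Fin n => γ) {z | ‖(n : ℝ)⁻¹ • ∑ i, f (z i) - y‖ < r} := by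
  -- Three gaps: up to `c₁` for the tilting cost, up to `c₂` for fluctuations of the mean (`‖θ‖ *
  -- s`), up to `c'` for the factor one half.
  obtain ⟨c₁, hc₁, hc₁'⟩ := exists_between hc
  obtain ⟨c₂, hc₂, hc₂'⟩ := exists_between hc₁'
  obtain ⟨h, θ, b, M, hh, hprob, hle, hM, hmy, hθm⟩ :=
    exists_withDensity_mean_close hf H hc₁ (half_pos hr)
  set ρ := γ.withDensity h with hρ
  set m := ∫ w, f w ∂ρ with hm
  set s := min (r / 2) ((c₂ - c₁) / (‖θ‖ + 1)) with hs
  have hs0 : 0 < s := lt_min (half_pos hr) (div_pos (sub_pos.2 hc₂) (by positivity))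
  have hθs : ‖θ‖ * s ≤ c₂ - c₁ := by
    calc ‖θ‖ * s ≤ (‖θ‖ + 1) * ((c₂ - c₁) / (‖θ‖ + 1)) := by
          refine mul_le_mul (by linarith) (min_le_right _ _) hs0.le (by positivity)
      _ = c₂ - c₁ := by field_simp
  filter_upwards [eventually_half_le_pi_norm_mean_sub_lt hf hM hs0, eventually_gt_atTop 0,
    eventually_const_mul_exp_neg_le 2 hc₂'] with n hn hn0 hexp
  have hn0' : (0 : ℝ) < n := by exact_mod_cast hn0
  set B := {z : Fin n → W | ‖(n : ℝ)⁻¹ • ∑ i, f (z i) - m‖ < s} with hB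
  have hBm : MeasurableSet B := measurableSet_lt (by fun_prop) measurable_const
  have hBsub : B ⊆ {z | ‖(n : ℝ)⁻¹ • ∑ i, f (z i) - y‖ < r} := fun z hz => by
    rw [hB, Set.mem_ofPred_eq] at hz
    rw [Set.mem_ofPred_eq]
    have h1 : s ≤ r / 2 := min_le_left _ _
    have h2 := norm_sub_le_norm_sub_add_norm_sub ((n : ℝ)⁻¹ • ∑ i, f (z i)) m y
    linarith
  -- Change of measure: on `B` the product density is at most `exp (n * c₂)`, because the empirical
  -- mean is within `s` of `m`.
  have hBle : (Measure.pi fun _ : Fin n => ρ) B ≤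
      ENNReal.ofReal (Real.exp (n * c₂)) * (Measure.pi fun _ : Fin n => γ) B := by
    rw [hρ, pi_withDensity hh, withDensity_apply _ hBm, ← setLIntegral_const]
    refine setLIntegral_mono' hBm fun z hz => ?_
    calc ∏ i, h (z i) ≤ ∏ i, ENNReal.ofReal (Real.exp (⟪θ, f (z i)⟫ - b)) :=
          Finset.prod_le_prod' fun i _ => hle _
      _ = ENNReal.ofReal (Real.exp (∑ i, (⟪θ, f (z i)⟫ - b))) := by
          rw [Real.exp_sum, ENNReal.ofReal_prod_of_nonneg fun _ _ => (Real.exp_pos _).le]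
      _ ≤ _ := by
          refine ENNReal.ofReal_le_ofReal (Real.exp_le_exp.2 ?_)
          have hz' : ‖(n : ℝ)⁻¹ • ∑ i, f (z i) - m‖ < s := hz
          set x := (n : ℝ)⁻¹ • ∑ i, f (z i) with hx
          have hsum : ∑ i, (⟪θ, f (z i)⟫ - b) = n * (⟪θ, x⟫ - b) := by
            rw [Finset.sum_sub_distrib, ← inner_sum, hx, real_inner_smul_right]
            simp only [Finset.sum_const, Finset.card_univ, Fintype.card_fin, nsmul_eq_mul]
            field_simp
          rw [hsum]
          refine mul_le_mul_of_nonneg_left ?_ hn0'.le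
          have h1 : ⟪θ, x⟫ = ⟪θ, x - m⟫ + ⟪θ, m⟫ := by rw [← inner_add_right, sub_add_cancel]
          have h2 : ⟪θ, x - m⟫ ≤ ‖θ‖ * s := (real_inner_le_norm _ _).trans (by gcongr)
          linarith
  have hhalf := hn.trans hBle
  calc ENNReal.ofReal (Real.exp (-(n * c')))
      ≤ ENNReal.ofReal (Real.exp (-(n * c₂)) * (1 / 2)) := by
        refine ENNReal.ofReal_le_ofReal ?_
        rw [← ENNReal.ofReal_mul zero_le_two,
          ENNReal.ofReal_le_ofReal_iff (Real.exp_pos _).le] at hexp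
        linarith
    _ = ENNReal.ofReal (Real.exp (-(n * c₂))) * (1 / 2) := by
        rw [ENNReal.ofReal_mul (Real.exp_pos _).le, ENNReal.ofReal_div_of_pos two_pos]; simp
    _ ≤ ENNReal.ofReal (Real.exp (-(n * c₂))) *
        (ENNReal.ofReal (Real.exp (n * c₂)) * (Measure.pi fun _ : Fin n => γ) B) := by gcongr
    _ = (Measure.pi fun _ : Fin n => γ) B := by
        rw [← mul_assoc, ← ENNReal.ofReal_mul (Real.exp_pos _).le, ← Real.exp_add]; simp
    _ ≤ _ := measure_mono hBsub

end CramerLowerBound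

/-! ### Positive semidefinite matrices as Euclidean vectors. -/

section MatrixVectors

open scoped RealInnerProductSpace

/-- The entries of a matrix as a Euclidean vector, so that the Euclidean norm becomes the
Frobenius norm. -/
def matVec {d : ℕ} : Matrix (Fin d) (Fin d) ℝ →ₗ[ℝ] EuclideanSpace ℝ (Fin d × Fin d) where
  toFun A := WithLp.toLp 2 fun p => A p.1 p.2
  map_add' _ _ := rfl
  map_smul' _ _ := rfl

lemma matVec_apply {d : ℕ} (A : Matrix (Fin d) (Fin d) ℝ) (p : Fin d × Fin d) :
    matVec A p = A p.1 p.2 := rfl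

lemma inner_matVec {d : ℕ} (A B : Matrix (Fin d) (Fin d) ℝ) :
    ⟪matVec A, matVec B⟫ = (A.transpose * B).trace := by
  simp only [PiLp.inner_apply, matVec_apply, Matrix.trace, Matrix.diag_apply, Matrix.mul_apply,
    Matrix.transpose_apply, Fintype.sum_prod_type, RCLike.inner_apply, conj_trivial]
  rw [Finset.sum_comm]
  simp only [mul_comm]

lemma norm_matVec {d : ℕ} (A : Matrix (Fin d) (Fin d) ℝ) : ‖matVec A‖ = frobNorm A := by
  rw [frobNorm, ← inner_matVec, real_inner_self_eq_norm_sq, Real.sqrt_sq (norm_nonneg _)]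

lemma isClosed_posSemidef (d : ℕ) :
    IsClosed {A : Matrix (Fin d) (Fin d) ℝ | A.PosSemidef} := by
  simp only [Matrix.posSemidef_iff_dotProduct_mulVec, Set.ofPred_and, Set.ofPred_forall,
    Matrix.IsHermitian]
  refine IsClosed.inter (isClosed_eq (by fun_prop) (by fun_prop))
    (isClosed_iInter fun v => isClosed_le continuous_const ?_)
  fun_prop

lemma isClosedEmbedding_matVec (d : ℕ) :
    IsClosedEmbedding fun Q : PSD d => matVec Q.1 := by
  have hinj : Function.Injective (matVec (d := d)) := fun A B h => by
    ext i j
    exact congrFun (congrArg WithLp.ofLp h) (i, j)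
  have h1 : IsClosedEmbedding (matVec (d := d)) :=
    LinearMap.isClosedEmbedding_of_injective (LinearMap.ker_eq_bot.2 hinj)
  exact h1.comp (isClosed_posSemidef d).isClosedEmbedding_subtypeVal

lemma continuous_matVec (d : ℕ) : Continuous fun Q : PSD d => matVec Q.1 :=
  (isClosedEmbedding_matVec d).continuous

lemma exists_norm_matVec_sub_lt_subset {d : ℕ} {y : PSD d} {V : Set (PSD d)} (hV : V ∈ 𝓝 y) :
    ∃ r > 0, {y' : PSD d | ‖matVec y'.1 - matVec y.1‖ < r} ⊆ V := by
  rw [(isClosedEmbedding_matVec d).isInducing.nhds_eq_comap] at hV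
  obtain ⟨r, hr, h⟩ := (Metric.nhds_basis_ball.comap _).mem_iff.1 hV
  exact ⟨r, hr, fun y' hy' => h (by simpa [dist_eq_norm] using hy')⟩

lemma isCompact_norm_matVec_le {d : ℕ} (R : ℝ) : IsCompact {y : PSD d | ‖matVec y.1‖ ≤ R} := by
  have := (isClosedEmbedding_matVec d).isCompact_preimage
    (isCompact_closedBall (0 : EuclideanSpace ℝ (Fin d × Fin d)) R)
  simpa [Set.preimage, mem_closedBall_zero_iff] using this

lemma matVec_empMean {d C : ℕ} (A : Fin C → PSD d) :
    matVec (empMean A).1 = (C : ℝ)⁻¹ • ∑ c, matVec (A c).1 := by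
  simp [empMean]

end MatrixVectors

/-! ### Continuity of the square root and Gaussian coupling. -/

section SquareRoot

open scoped MatrixOrder Matrix.Norms.L2Operator

/-- The operator `√Q` on Euclidean space. -/
def sqrtOp {d : ℕ} (Q : PSD d) : Vec d →L[ℝ] Vec d :=
  Matrix.toEuclideanCLM (𝕜 := ℝ) (CFC.sqrt Q.1)

lemma sqrtOp_apply {d : ℕ} (Q : PSD d) (z : Vec d) : sqrtOp Q z = sqrtMul Q z := rfl

lemma continuous_sqrtOp (d : ℕ) : Continuous (sqrtOp (d := d)) := by
  have h1 : Continuous fun Q : PSD d => CFC.sqrt Q.1 :=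
    CFC.continuousOn_sqrt.comp_continuous continuous_subtype_val fun Q =>
      Matrix.nonneg_iff_posSemidef.2 Q.2
  have h2 : Continuous (Matrix.toEuclideanCLM (n := Fin d) (𝕜 := ℝ)) :=
    LinearMap.continuous_of_finiteDimensional
      (Matrix.toEuclideanCLM (n := Fin d) (𝕜 := ℝ)).toAlgEquiv.toLinearMap
  exact h2.comp h1

lemma continuous_sqrtMul (d : ℕ) : Continuous fun p : PSD d × Vec d => sqrtMul p.1 p.2 :=
  ((continuous_sqrtOp d).comp continuous_fst).clm_apply continuous_snd

/-- This couples all covariances to one standard Gaussian vector: changing `Q` changes only the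
integrand. -/
lemma multivariateGaussian_zero_eq_map {d : ℕ} (Q : PSD d) :
    multivariateGaussian 0 Q.1 = (stdGaussian (Vec d)).map (sqrtMul Q) := by
  rw [multivariateGaussian]
  simp only [zero_add]
  rfl

end SquareRoot

/-! ### Stability of the summand under a change of covariance. -/

section Increments

variable {d d' : ℕ}

lemma continuous_comp_sqrtMul {g : Vec d → PSD d'} (hg : Continuous g) :
    Continuous fun p : PSD d × Vec d => matVec (g (sqrtMul p.1 p.2)).1 :=
  (continuous_matVec d').comp (hg.comp (continuous_sqrtMul d))

/-- On a large ball this is joint continuity and compactness. Outside it, the three terms of the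
increment bound are each at most `ε / 3 * ‖z‖ ^ 2`. -/
lemma QuadraticIncrement.eventually_norm_sub_le {g : Vec d → PSD d'} (hg : QuadraticIncrement g)
    (x : PSD d) {ε : ℝ} (hε : 0 < ε) :
    ∀ᶠ x' in 𝓝 x, ∀ z : Vec d,
      ‖matVec (g (sqrtMul x' z)).1 - matVec (g (sqrtMul x z)).1‖ ≤ ε * (1 + ‖z‖ ^ 2) := by
  -- `B` bounds both square roots since `δ ≤ 1`. Beyond `R` the constant `K` is below `ε / 3 * ‖z‖ ^
  -- 2`, and `δ` makes the mixed term equally small.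
  set B : ℝ := ‖sqrtOp x‖ + 1 with hB
  have hB1 : 1 ≤ B := le_add_of_nonneg_left (norm_nonneg _)
  have hB0 : 0 < B := lt_of_lt_of_le one_pos hB1
  obtain ⟨K, hK0, hK⟩ := hg.2 (ε / (6 * B ^ 2)) (by positivity)
  set R : ℝ := Real.sqrt (3 * K / ε) with hR
  set δ : ℝ := min 1 (ε / (6 * B * K)) with hδ
  have hδ0 : 0 < δ := lt_min one_pos (by positivity)
  have hnear : ∀ᶠ x' in 𝓝 x, ‖sqrtOp x' - sqrtOp x‖ < δ := by
    have hc : Continuous fun x' => ‖sqrtOp x' - sqrtOp x‖ :=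
      ((continuous_sqrtOp d).sub continuous_const).norm
    have := hc.tendsto x
    simp only [sub_self, norm_zero] at this
    exact this.eventually_lt_const hδ0
  have hcpt : ∀ᶠ x' in 𝓝 x, ∀ z ∈ Metric.closedBall (0 : Vec d) R,
      ‖matVec (g (sqrtMul x' z)).1 - matVec (g (sqrtMul x z)).1‖ < ε := by
    refine (isCompact_closedBall (0 : Vec d) R).eventually_forall_of_forall_eventually fun z _ => ?_
    have hc : Continuous fun p : PSD d × Vec d =>
        ‖matVec (g (sqrtMul p.1 p.2)).1 - matVec (g (sqrtMul x p.2)).1‖ :=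
      ((continuous_comp_sqrtMul hg.1).sub ((continuous_comp_sqrtMul hg.1).comp
        (continuous_const.prodMk continuous_snd))).norm
    have := hc.tendsto (x, z)
    simp only [sub_self, norm_zero] at this
    exact this.eventually_lt_const hε
  filter_upwards [hnear, hcpt] with x' hx' hcx' z
  by_cases hz : ‖z‖ ≤ R
  · refine (hcx' z (by simpa using hz)).le.trans ?_
    have : 0 ≤ ε * ‖z‖ ^ 2 := by positivity
    linarith
  · push Not at hz
    have hKz : K ≤ ε / 3 * ‖z‖ ^ 2 := by
      have h1 : R ^ 2 < ‖z‖ ^ 2 := by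
        have : 0 ≤ R := Real.sqrt_nonneg _
        gcongr
      rw [hR, Real.sq_sqrt (by positivity), div_lt_iff₀ hε] at h1
      linarith
    have hδ1 : δ ≤ 1 := min_le_left _ _
    have hδ2 : δ * (6 * B * K) ≤ ε := by
      have : δ ≤ ε / (6 * B * K) := min_le_right _ _
      rwa [le_div_iff₀ (by positivity)] at this
    have hsub : ‖sqrtMul x' z - sqrtMul x z‖ ≤ δ * ‖z‖ := by
      rw [← sqrtOp_apply, ← sqrtOp_apply, ← sub_apply]
      exact (ContinuousLinearMap.le_opNorm _ _).trans (by gcongr)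
    have hx : ‖sqrtMul x z‖ ≤ B * ‖z‖ := by
      rw [← sqrtOp_apply]
      exact (ContinuousLinearMap.le_opNorm _ _).trans (by gcongr; linarith)
    have hx2 : ‖sqrtMul x' z‖ ≤ B * ‖z‖ := by
      rw [← sqrtOp_apply]
      refine (ContinuousLinearMap.le_opNorm _ _).trans ?_
      gcongr
      have := norm_le_norm_add_norm_sub' (sqrtOp x') (sqrtOp x)
      linarith
    rw [← map_sub, norm_matVec]
    refine (hK _ _).trans ?_
    calc K * (1 + ‖sqrtMul x' z - sqrtMul x z‖ * (‖sqrtMul x' z‖ + ‖sqrtMul x z‖)) +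
          ε / (6 * B ^ 2) * (‖sqrtMul x' z‖ ^ 2 + ‖sqrtMul x z‖ ^ 2)
        ≤ K * (1 + δ * ‖z‖ * (B * ‖z‖ + B * ‖z‖)) +
          ε / (6 * B ^ 2) * ((B * ‖z‖) ^ 2 + (B * ‖z‖) ^ 2) := by gcongr
      _ = K + δ * (6 * B * K) * ‖z‖ ^ 2 / 3 + ε / 3 * ‖z‖ ^ 2 := by field_simp; ring
      _ ≤ ε / 3 * ‖z‖ ^ 2 + ε * ‖z‖ ^ 2 / 3 + ε / 3 * ‖z‖ ^ 2 := by gcongr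
      _ ≤ ε * (1 + ‖z‖ ^ 2) := by linarith

lemma QuadraticIncrement.exists_norm_le {g : Vec d → PSD d'} (hg : QuadraticIncrement g)
    {K : Set (PSD d)} (hK : IsCompact K) :
    ∃ A : ℝ, 0 < A ∧ ∀ x ∈ K, ∀ z : Vec d,
      ‖matVec (g (sqrtMul x z)).1‖ ≤ A * (1 + ‖z‖ ^ 2) := by
  obtain ⟨c, hc0, hc⟩ := hg.2 1 one_pos
  obtain ⟨B, hB⟩ := hK.exists_bound_of_continuousOn (continuous_sqrtOp d).continuousOn
  refine ⟨‖matVec (g 0).1‖ + c * (1 + B ^ 2) + B ^ 2, by positivity, fun x hx z => ?_⟩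
  have hxz : ‖sqrtMul x z‖ ≤ B * ‖z‖ := by
    rw [← sqrtOp_apply]
    exact (ContinuousLinearMap.le_opNorm _ _).trans (by gcongr; exact hB x hx)
  have hsq : ‖sqrtMul x z‖ ^ 2 ≤ B ^ 2 * ‖z‖ ^ 2 := by
    rw [← mul_pow]; gcongr
  have h1 := hc (sqrtMul x z) 0
  rw [← norm_matVec, map_sub] at h1
  simp only [sub_zero, norm_zero, add_zero, one_mul, ne_eq, OfNat.ofNat_ne_zero, not_false_eq_true,
    zero_pow] at h1
  have h2 := norm_le_norm_add_norm_sub' (matVec (g (sqrtMul x z)).1) (matVec (g 0).1)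
  have h3 : c * (1 + ‖sqrtMul x z‖ * ‖sqrtMul x z‖) ≤ c * (1 + B ^ 2 * ‖z‖ ^ 2) := by
    rw [← pow_two]; gcongr
  have h4 : 0 ≤ ‖matVec (g 0).1‖ * ‖z‖ ^ 2 := by positivity
  have h5 : 0 ≤ c * B ^ 2 := by positivity
  have h6 : 0 ≤ c * ‖z‖ ^ 2 := by positivity
  have h7 : 0 ≤ B ^ 2 := by positivity
  nlinarith

end Increments

/-! ### Quadratic exponential moments of Gaussian vectors. -/

section GaussianMoments

/-- Fernique's theorem gives one finite moment; decreasing the exponent brings it close to one. -/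
lemma exists_lintegral_exp_sq_le (d : ℕ) {η : ℝ} (hη : 0 < η) :
    ∃ t : ℝ, 0 < t ∧ ∫⁻ z : Vec d, ENNReal.ofReal (Real.exp (t * (1 + ‖z‖ ^ 2)))
      ∂(stdGaussian (Vec d)) ≤ ENNReal.ofReal (Real.exp η) := by
  obtain ⟨t₀, ht₀, hint⟩ := IsGaussian.exists_integrable_exp_sq (stdGaussian (Vec d))
  refine exists_lintegral_exp_mul_le (by fun_prop) ht₀ ?_ hη
  have h2 : Integrable (fun z : Vec d => Real.exp (t₀ * (1 + ‖z‖ ^ 2))) (stdGaussian (Vec d)) := by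
    simp_rw [mul_add, Real.exp_add]
    exact hint.const_mul _
  exact (hasFiniteIntegral_iff_ofReal (Eventually.of_forall fun z => (Real.exp_pos _).le)).1
    h2.hasFiniteIntegral |>.ne

/-- Chernoff's bound, where the extra one in `b + 1` pays for the moment `exp 1` per sample. Outside
this event, an error `ε * (1 + ‖z‖ ^ 2)` per sample averages to less than `ε * (b + 1) / t`. -/
lemma pi_le_sum_sq_le {d : ℕ} {t : ℝ} (ht0 : 0 < t)
    (ht : ∫⁻ z : Vec d, ENNReal.ofReal (Real.exp (t * (1 + ‖z‖ ^ 2)))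
      ∂(stdGaussian (Vec d)) ≤ ENNReal.ofReal (Real.exp 1)) (C : ℕ) (b : ℝ) :
    (Measure.pi fun _ : Fin C => stdGaussian (Vec d))
      {z | C * ((b + 1) / t) ≤ ∑ c, (1 + ‖z c‖ ^ 2)} ≤ ENNReal.ofReal (Real.exp (-(C * b))) := by
  have h := pi_le_sum_le_exp_mul_pow (γ := stdGaussian (Vec d))
    (φ := fun z => t * (1 + ‖z‖ ^ 2)) (by fun_prop) C (C * (b + 1))
  refine (measure_mono fun z hz => ?_).trans (h.trans ?_)
  · rw [Set.mem_ofPred_eq] at hz ⊢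
    rw [← Finset.mul_sum]
    calc (C : ℝ) * (b + 1) = t * (C * ((b + 1) / t)) := by field_simp
      _ ≤ _ := by gcongr
  · calc _ ≤ ENNReal.ofReal (Real.exp (-(C * (b + 1)))) * ENNReal.ofReal (Real.exp 1) ^ C := by
          gcongr
      _ = _ := by
          rw [← ENNReal.ofReal_pow (Real.exp_pos _).le, ← ENNReal.ofReal_mul (Real.exp_pos _).le,
            ← Real.exp_nat_mul, ← Real.exp_add]
          congr 2; ring

end GaussianMoments

/-! ### Locally uniform bounds for one transition. -/

section TransitionBounds

open scoped RealInnerProductSpace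

variable {d d' : ℕ}

lemma continuous_sqrtMul_right (x : PSD d) : Continuous (sqrtMul x) := (sqrtOp x).continuous

lemma measurable_empMean_sqrtMul {g : Vec d → PSD d'} (hg : Continuous g) (C : ℕ) (x : PSD d) :
    Measurable fun Z : Fin C → Vec d => empMean fun c => g (sqrtMul x (Z c)) := by
  refine Continuous.measurable (Continuous.subtype_mk ?_ _)
  have h : ∀ c : Fin C, Continuous fun Z : Fin C → Vec d => (g (sqrtMul x (Z c))).1 := fun c =>
    continuous_subtype_val.comp (hg.comp ((continuous_sqrtMul_right x).comp (continuous_apply c)))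
  exact (continuous_finsetSum _ fun c _ => h c).const_smul ((C : ℝ)⁻¹)

lemma transition_apply {g : Vec d → PSD d'} (hg : Continuous g) (C : ℕ) (x : PSD d)
    {B : Set (PSD d')} (hB : MeasurableSet B) :
    transition g C x B = (Measure.pi fun _ : Fin C => stdGaussian (Vec d))
      {Z | (empMean fun c => g (sqrtMul x (Z c))) ∈ B} :=
  Measure.map_apply (measurable_empMean_sqrtMul hg C x) hB

lemma isProbabilityMeasure_transition {g : Vec d → PSD d'} (hg : Continuous g) (C : ℕ)
    (x : PSD d) : IsProbabilityMeasure (transition g C x) :=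
  Measure.isProbabilityMeasure_map (measurable_empMean_sqrtMul hg C x).aemeasurable

lemma continuous_matVec_comp_sqrtMul {g : Vec d → PSD d'} (hg : Continuous g) (x : PSD d) :
    Continuous fun z : Vec d => matVec (g (sqrtMul x z)).1 :=
  (continuous_matVec d').comp (hg.comp (continuous_sqrtMul_right x))

lemma expMoment_eq {g : Vec d → PSD d'} (hg : Continuous g) (x : PSD d)
    (A : Matrix (Fin d') (Fin d') ℝ) :
    expMoment g x A = ∫⁻ z, ENNReal.ofReal (Real.exp ⟪matVec A, matVec (g (sqrtMul x z)).1⟫)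
      ∂(stdGaussian (Vec d)) := by
  have hs : Measurable (sqrtMul x) := (continuous_sqrtMul_right x).measurable
  have hm : Measurable fun z : Vec d =>
      ENNReal.ofReal (Real.exp ⟪matVec A, matVec (g z).1⟫) := by
    have : Continuous fun z : Vec d => matVec (g z).1 := (continuous_matVec d').comp hg
    exact ENNReal.measurable_ofReal.comp (Continuous.measurable (by fun_prop))
  rw [expMoment, multivariateGaussian_zero_eq_map]
  simp only [← inner_matVec]
  rw [lintegral_map hm hs]

lemma condRate_nonneg (g : Vec d → PSD d') (x : PSD d) (y : PSD d') : 0 ≤ condRate g x y := by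
  refine le_trans (le_of_eq ?_) (le_iSup _ ⟨0, Matrix.isSymm_zero⟩)
  simp [expMoment]

/-- The rate is a supremum over symmetric matrices only, but the pairing with a symmetric matrix
sees only the symmetric part of `A`. So Cramér's hypothesis holds in every direction `θ`. -/
lemma exp_sub_le_expMoment {g : Vec d → PSD d'} (hg : Continuous g) {x : PSD d} {y : PSD d'}
    {c : ℝ} (h : condRate g x y ≤ c) (θ : EuclideanSpace ℝ (Fin d' × Fin d')) :
    ENNReal.ofReal (Real.exp (⟪θ, matVec y.1⟫ - c)) ≤
      ∫⁻ z, ENNReal.ofReal (Real.exp ⟪θ, matVec (g (sqrtMul x z)).1⟫) ∂(stdGaussian (Vec d)) := by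
  obtain ⟨A, rfl⟩ : ∃ A, matVec A = θ := ⟨fun i j => θ (i, j), rfl⟩
  set S : Matrix (Fin d') (Fin d') ℝ := (1 / 2 : ℝ) • (A + A.transpose) with hS
  have hsymm : S.IsSymm := by
    rw [Matrix.IsSymm, hS, Matrix.transpose_smul, Matrix.transpose_add, Matrix.transpose_transpose,
      add_comm]
  have hinner : ∀ Q : PSD d', ⟪matVec A, matVec Q.1⟫ = ⟪matVec S, matVec Q.1⟫ := fun Q => by
    have hQ : Q.1.transpose = Q.1 := by
      have := Q.2.isHermitian
      rwa [Matrix.IsHermitian, Matrix.conjTranspose_eq_transpose_of_trivial] at this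
    have h1 : (A * Q.1).trace = (A.transpose * Q.1).trace := by
      rw [← Matrix.trace_transpose (A * Q.1), Matrix.transpose_mul, hQ, Matrix.trace_mul_comm]
    rw [inner_matVec, inner_matVec, hS, Matrix.transpose_smul, Matrix.transpose_add,
      Matrix.transpose_transpose, Matrix.smul_mul, Matrix.trace_smul, Matrix.add_mul,
      Matrix.trace_add, h1, smul_eq_mul]
    ring
  simp_rw [hinner]
  rw [← expMoment_eq hg, ← ENNReal.log_le_log_iff, log_ofReal_exp, EReal.coe_sub]
  have h1 := (le_iSup (fun Q₀ : {A : Matrix (Fin d') (Fin d') ℝ // A.IsSymm} =>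
    (((Q₀.1.transpose * y.1).trace : ℝ) : EReal) - ENNReal.log (expMoment g x Q₀.1))
    ⟨S, hsymm⟩).trans h
  rw [← inner_matVec] at h1
  exact EReal.sub_le_of_le_add' ((EReal.sub_le_iff_le_add (by simp) (by simp)).1 h1)

variable {α a : ℝ} {C : ℕ → ℕ}

lemma tendsto_atTop_of_div_tendsto (hα : 0 < α)
    (hC : Tendsto (fun n : ℕ => (C n : ℝ) / (n : ℝ)) atTop (𝓝 α)) : Tendsto C atTop atTop := by
  rw [← tendsto_natCast_atTop_iff (R := ℝ)]
  refine (hC.pos_mul_atTop hα tendsto_natCast_atTop_atTop).congr' ?_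
  filter_upwards [eventually_gt_atTop 0] with n hn
  have : (n : ℝ) ≠ 0 := by exact_mod_cast hn.ne'
  field_simp

lemma eventually_mul_le_of_div_tendsto {b : ℝ}
    (hC : Tendsto (fun n : ℕ => (C n : ℝ) / (n : ℝ)) atTop (𝓝 α)) (h : α * b < a) :
    ∀ᶠ n : ℕ in atTop, C n * b ≤ n * a := by
  filter_upwards [(hC.mul_const b).eventually_le_const h, eventually_gt_atTop 0] with n hn hn0
  have : (0 : ℝ) < n := by exact_mod_cast hn0
  rw [div_mul_eq_mul_div, div_le_iff₀ this] at hn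
  linarith

lemma eventually_le_mul_of_div_tendsto {b : ℝ}
    (hC : Tendsto (fun n : ℕ => (C n : ℝ) / (n : ℝ)) atTop (𝓝 α)) (h : a < α * b) :
    ∀ᶠ n : ℕ in atTop, n * a ≤ C n * b := by
  filter_upwards [eventually_mul_le_of_div_tendsto (a := -a) (b := -b) hC (by linarith)] with n hn
  linarith

/-- Cramér's lower bound is applied at `x` alone with radius `r / 2`. The same sample serves every
nearby `x'`: unless the sum of squares is large, the two empirical means differ by less than `r /
2`. -/
lemma transition_lower {g : Vec d → PSD d'} (hg : QuadraticIncrement g) (hα : 0 < α)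
    (hC : Tendsto (fun n : ℕ => (C n : ℝ) / (n : ℝ)) atTop (𝓝 α)) {x : PSD d} {y : PSD d'}
    (h : (α : EReal) * condRate g x y < a) {V : Set (PSD d')} (hV : V ∈ 𝓝 y) :
    ∃ U ∈ 𝓝 x, ∀ᶠ n : ℕ in atTop, ∀ x' ∈ U,
      ENNReal.ofReal (Real.exp (-(n * a))) ≤ transition g (C n) x' V := by
  have htop : condRate g x y ≠ ⊤ := fun h0 => by
    rw [h0, EReal.coe_mul_top_of_pos hα] at h
    exact absurd h (by simp)
  have hbot : condRate g x y ≠ ⊥ := fun h0 => by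
    have := condRate_nonneg g x y
    rw [h0] at this
    simp at this
  obtain ⟨c, hc⟩ : ∃ c : ℝ, condRate g x y = c := ⟨_, (EReal.coe_toReal htop hbot).symm⟩
  rw [hc, ← EReal.coe_mul, EReal.coe_lt_coe_iff] at h
  have hca : c < a / α := by rw [lt_div_iff₀ hα]; linarith
  obtain ⟨c₁, hc₁, hc₁'⟩ := exists_between hca
  obtain ⟨c₂, hc₂, hc₂'⟩ := exists_between hc₁'
  obtain ⟨r, hr, hrV⟩ := exists_norm_matVec_sub_lt_subset hV
  obtain ⟨t, ht0, ht⟩ := exists_lintegral_exp_sq_le d one_pos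
  have hc0 : 0 ≤ c := by
    have := condRate_nonneg g x y
    rw [hc] at this
    exact_mod_cast this
  -- The rate `b > c₁` makes the bad event at most half the Cramér bound; `ε` is chosen so that `ε *
  -- ((b + 1) / t) = r / 2`.
  set b : ℝ := c₁ + 1 with hb
  have hb0 : 0 < b := by linarith
  set ε : ℝ := r / 2 / ((b + 1) / t) with hε
  have hε0 : 0 < ε := by positivity
  refine ⟨_, hg.eventually_norm_sub_le x hε0, ?_⟩
  have hcr := (tendsto_atTop_of_div_tendsto hα hC).eventually
    (eventually_exp_neg_le_pi_norm_mean_sub_lt (γ := stdGaussian (Vec d))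
      (continuous_matVec_comp_sqrtMul hg.1 x).measurable
      (exp_sub_le_expMoment hg.1 hc.le) hc₁ (half_pos hr))
  have h2 := (tendsto_atTop_of_div_tendsto hα hC).eventually
    (eventually_const_mul_exp_neg_le 2 (show c₁ < b by linarith))
  have h3 := (tendsto_atTop_of_div_tendsto hα hC).eventually
    (eventually_const_mul_exp_neg_le 2 hc₂)
  have h4 := (tendsto_atTop_of_div_tendsto hα hC).eventually (eventually_gt_atTop 0)
  have h5 := eventually_mul_le_of_div_tendsto (a := a) (b := c₂) hC (by
    rw [lt_div_iff₀ hα] at hc₂'; linarith)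
  filter_upwards [hcr, h2, h3, h4, h5] with n hn1 hn2 hn3 hn4 hn5 x' hx'
  set m := C n with hm
  have hm0 : (0 : ℝ) < m := by exact_mod_cast hn4
  set π := Measure.pi fun _ : Fin m => stdGaussian (Vec d) with hπ
  set Y := {y' : PSD d' | ‖matVec y'.1 - matVec y.1‖ < r} with hY
  have hYm : MeasurableSet Y := by
    have : IsOpen Y := isOpen_lt (((continuous_matVec d').sub continuous_const).norm)
      continuous_const
    exact this.measurableSet
  set p := π {Z | (empMean fun c => g (sqrtMul x' (Z c))) ∈ Y} with hp
  set e := ENNReal.ofReal (Real.exp (-(m * c₁))) with he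
  set q := ENNReal.ofReal (Real.exp (-(m * b))) with hq
  have hcover : e ≤ p + q := by
    refine hn1.trans ((measure_mono ?_).trans ((measure_union_le _ _).trans
      (add_le_add_right (pi_le_sum_sq_le ht0 ht m b) _)))
    intro Z hZ
    rw [Set.mem_ofPred_eq] at hZ
    by_cases hbad : m * ((b + 1) / t) ≤ ∑ c, (1 + ‖Z c‖ ^ 2)
    · exact Or.inr hbad
    left
    push Not at hbad
    rw [Set.mem_ofPred_eq, hY, Set.mem_ofPred_eq, matVec_empMean]
    have hdiff : ‖(m : ℝ)⁻¹ • ∑ c, matVec (g (sqrtMul x' (Z c))).1 -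
        (m : ℝ)⁻¹ • ∑ c, matVec (g (sqrtMul x (Z c))).1‖ < r / 2 := by
      rw [← smul_sub, ← Finset.sum_sub_distrib, norm_smul, norm_inv, Real.norm_natCast,
        inv_mul_lt_iff₀ hm0]
      calc ‖∑ c, (matVec (g (sqrtMul x' (Z c))).1 - matVec (g (sqrtMul x (Z c))).1)‖
          ≤ ∑ c, ε * (1 + ‖Z c‖ ^ 2) := norm_sum_le_of_le _ fun c _ => hx' (Z c)
        _ = ε * ∑ c, (1 + ‖Z c‖ ^ 2) := (Finset.mul_sum _ _ _).symm
        _ < ε * (m * ((b + 1) / t)) := by gcongr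
        _ = m * (r / 2) := by rw [hε]; field_simp
    have := norm_sub_le_norm_sub_add_norm_sub
      ((m : ℝ)⁻¹ • ∑ c, matVec (g (sqrtMul x' (Z c))).1)
      ((m : ℝ)⁻¹ • ∑ c, matVec (g (sqrtMul x (Z c))).1) (matVec y.1)
    linarith
  have htwo : ENNReal.ofReal 2 = 2 := by simp
  rw [htwo] at hn2 hn3
  have he2 : e ≤ 2 * p := by
    have h1 : e + e ≤ e + 2 * p := by
      calc e + e = 2 * e := (two_mul e).symm
        _ ≤ 2 * (p + q) := by gcongr
        _ = 2 * p + 2 * q := mul_add _ _ _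
        _ ≤ 2 * p + e := by gcongr
        _ = e + 2 * p := add_comm _ _
    exact (ENNReal.add_le_add_iff_left ENNReal.ofReal_ne_top).1 h1
  have hfin : ENNReal.ofReal (Real.exp (-(m * c₂))) ≤ p :=
    (ENNReal.mul_le_mul_iff_right two_ne_zero ENNReal.ofNat_ne_top).1 (hn3.trans he2)
  calc ENNReal.ofReal (Real.exp (-(n * a))) ≤ ENNReal.ofReal (Real.exp (-(m * c₂))) :=
        ENNReal.ofReal_le_ofReal (Real.exp_le_exp.2 (neg_le_neg hn5))
    _ ≤ p := hfin
    _ = transition g m x' Y := (transition_apply hg.1 m x' hYm).symm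
    _ ≤ transition g m x' V := measure_mono hrV

/-- A direction `θ` whose Legendre gap exceeds `a / α` yields a half-space around `y` for Chernoff's
bound. The finite moment at `x` need not give one at `x'` for the same `θ`, so `t * θ` with `t < 1`
is used; the spare Hölder exponent `1 - t` pays for the quadratic error. -/
lemma transition_upper {g : Vec d → PSD d'} (hg : QuadraticIncrement g) (hα : 0 < α)
    (hC : Tendsto (fun n : ℕ => (C n : ℝ) / (n : ℝ)) atTop (𝓝 α)) {x : PSD d} {y : PSD d'}
    (h : (a : EReal) < (α : EReal) * condRate g x y) :
    ∃ U ∈ 𝓝 x, ∃ V ∈ 𝓝 y, ∀ᶠ n : ℕ in atTop, ∀ x' ∈ U,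
      transition g (C n) x' V ≤ ENNReal.ofReal (Real.exp (-(n * a))) := by
  have hα' : (0 : EReal) ≤ α := by exact_mod_cast hα.le
  have h1 : ((a / α : ℝ) : EReal) < condRate g x y := by
    by_contra! hle
    refine absurd h (not_lt.2 ((mul_le_mul_of_nonneg_left hle hα').trans (le_of_eq ?_)))
    rw [← EReal.coe_mul, mul_div_cancel₀ _ hα.ne']
  obtain ⟨⟨A, hA⟩, hlt⟩ := lt_iSup_iff.1 h1
  simp only [← inner_matVec, expMoment_eq hg.1] at hlt
  set θ := matVec A with hθ
  set M := ∫⁻ z, ENNReal.ofReal (Real.exp ⟪θ, matVec (g (sqrtMul x z)).1⟫)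
    ∂(stdGaussian (Vec d)) with hM
  obtain ⟨Λ, hMΛ, hgap⟩ : ∃ Λ : ℝ, M ≤ ENNReal.ofReal (Real.exp Λ) ∧
      a / α < ⟪θ, matVec y.1⟫ - Λ := by
    have hlt2 : ENNReal.log M < ((⟪θ, matVec y.1⟫ - a / α : ℝ) : EReal) := by
      rw [EReal.coe_sub]
      refine EReal.lt_sub_iff_add_lt (by simp) (by simp) |>.2 ?_
      rw [add_comm]
      refine EReal.add_lt_of_lt_sub ?_
      exact hlt
    obtain ⟨Λ, hΛ1, hΛ2⟩ := EReal.lt_iff_exists_real_btwn.1 hlt2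
    refine ⟨Λ, ?_, ?_⟩
    · rw [← ENNReal.log_le_log_iff, log_ofReal_exp]
      exact hΛ1.le
    · rw [EReal.coe_lt_coe_iff] at hΛ2
      linarith
  set β := ⟪θ, matVec y.1⟫ with hβ
  set a' := a / α with ha'
  obtain ⟨t, ht0, ht1, hta⟩ : ∃ t : ℝ, 0 < t ∧ t < 1 ∧ a' < t * (β - Λ) := by
    have hc : Tendsto (fun t : ℝ => t * (β - Λ)) (𝓝[<] 1) (𝓝 (1 * (β - Λ))) :=
      ((continuous_id.mul continuous_const).tendsto 1).mono_left nhdsWithin_le_nhds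
    rw [one_mul] at hc
    obtain ⟨t, h1, h2, h3⟩ := ((hc.eventually_const_lt hgap).and
      ((eventually_mem_nhdsWithin).and
        (eventually_nhdsWithin_of_eventually_nhds (eventually_gt_nhds one_pos)))).exists
    exact ⟨t, h3, h2, h1⟩
  -- Widening the half-space costs `t * η` and perturbing the moment costs `η`, together at most `2
  -- * η`. The remaining `2 * η` covers the convergence of `C n / n` to `α`.
  set η := (t * (β - Λ) - a') / 4 with hη
  have hη0 : 0 < η := by rw [hη]; linarith
  obtain ⟨s, hs0, hs⟩ := exists_lintegral_exp_sq_le d hη0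
  -- Calibrated so that the error `t * ‖θ‖ * ε` fits under `(1 - t) * s`.
  set ε := s * (1 - t) / (t * ‖θ‖ + 1) with hε
  have hε0 : 0 < ε := div_pos (mul_pos hs0 (sub_pos.2 ht1)) (by positivity)
  have hεle : t * ‖θ‖ * ε ≤ (1 - t) * s := by
    calc t * ‖θ‖ * ε ≤ (t * ‖θ‖ + 1) * ε := by gcongr; linarith
      _ = (1 - t) * s := by rw [hε]; field_simp
  set V := {y' : PSD d' | β - η < ⟪θ, matVec y'.1⟫} with hV
  have hVo : IsOpen V := isOpen_lt continuous_const
    (continuous_const.inner (continuous_matVec d'))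
  refine ⟨_, hg.eventually_norm_sub_le x hε0, V, hVo.mem_nhds ?_, ?_⟩
  · rw [hV, Set.mem_ofPred_eq]; linarith
  have h4 := (tendsto_atTop_of_div_tendsto hα hC).eventually (eventually_gt_atTop 0)
  have h5 := eventually_le_mul_of_div_tendsto (a := a) (b := t * (β - Λ) - 2 * η) hC (by
    have : a' < t * (β - Λ) - 2 * η := by rw [hη]; linarith
    rw [ha', div_lt_iff₀ hα] at this
    linarith)
  filter_upwards [h4, h5] with n hn4 hn5 x' hx'
  set m := C n with hm
  have hm0 : (0 : ℝ) < m := by exact_mod_cast hn4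
  have hmeas := (continuous_matVec_comp_sqrtMul hg.1 x).measurable
  have hmeas' := (continuous_matVec_comp_sqrtMul hg.1 x').measurable
  have hmom : ∫⁻ z, ENNReal.ofReal (Real.exp (t * ⟪θ, matVec (g (sqrtMul x' z)).1⟫))
      ∂(stdGaussian (Vec d)) ≤ ENNReal.ofReal (Real.exp (t * Λ + η)) := by
    calc _ ≤ ∫⁻ z, ENNReal.ofReal (Real.exp (t * ⟪θ, matVec (g (sqrtMul x z)).1⟫ +
          (1 - t) * (s * (1 + ‖z‖ ^ 2)))) ∂(stdGaussian (Vec d)) := by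
          refine lintegral_mono fun z => ENNReal.ofReal_le_ofReal (Real.exp_le_exp.2 ?_)
          have e1 : ⟪θ, matVec (g (sqrtMul x' z)).1⟫ - ⟪θ, matVec (g (sqrtMul x z)).1⟫ ≤
              ‖θ‖ * (ε * (1 + ‖z‖ ^ 2)) := by
            rw [← inner_sub_right]
            exact (real_inner_le_norm _ _).trans (by gcongr; exact hx' z)
          have e2 : t * (‖θ‖ * (ε * (1 + ‖z‖ ^ 2))) ≤ (1 - t) * (s * (1 + ‖z‖ ^ 2)) := by
            calc t * (‖θ‖ * (ε * (1 + ‖z‖ ^ 2))) = t * ‖θ‖ * ε * (1 + ‖z‖ ^ 2) := by ring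
              _ ≤ (1 - t) * s * (1 + ‖z‖ ^ 2) := by gcongr
              _ = _ := by ring
          have e3 := mul_le_mul_of_nonneg_left e1 ht0.le
          linarith
      _ ≤ M ^ t * (∫⁻ z : Vec d, ENNReal.ofReal (Real.exp (s * (1 + ‖z‖ ^ 2)))
            ∂(stdGaussian (Vec d))) ^ (1 - t) :=
          lintegral_exp_add_le (by fun_prop) (by fun_prop) ht0 ht1
      _ ≤ ENNReal.ofReal (Real.exp Λ) ^ t * ENNReal.ofReal (Real.exp η) ^ (1 - t) := by
          have := (sub_pos.2 ht1).le
          gcongr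
      _ = ENNReal.ofReal (Real.exp (Λ * t + η * (1 - t))) := by
          rw [ENNReal.ofReal_rpow_of_pos (Real.exp_pos _),
            ENNReal.ofReal_rpow_of_pos (Real.exp_pos _), ← Real.exp_mul, ← Real.exp_mul,
            ← ENNReal.ofReal_mul (Real.exp_pos _).le, ← Real.exp_add]
      _ ≤ _ := by
          refine ENNReal.ofReal_le_ofReal (Real.exp_le_exp.2 ?_)
          nlinarith
  rw [transition_apply hg.1 m x' hVo.measurableSet]
  calc _ ≤ (Measure.pi fun _ : Fin m => stdGaussian (Vec d))
        {Z | m * (t * (β - η)) ≤ ∑ c, t * ⟪θ, matVec (g (sqrtMul x' (Z c))).1⟫} := by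
        refine measure_mono fun Z hZ => ?_
        rw [Set.mem_ofPred_eq, hV, Set.mem_ofPred_eq, matVec_empMean, real_inner_smul_right,
          inner_sum, lt_inv_mul_iff₀ hm0] at hZ
        rw [Set.mem_ofPred_eq, ← Finset.mul_sum]
        calc m * (t * (β - η)) = t * (m * (β - η)) := by ring
          _ ≤ _ := by gcongr
    _ ≤ ENNReal.ofReal (Real.exp (-(m * (t * (β - η))))) *
        ENNReal.ofReal (Real.exp (t * Λ + η)) ^ m := by
        refine (pi_le_sum_le_exp_mul_pow
          (φ := fun z => t * ⟪θ, matVec (g (sqrtMul x' z)).1⟫) (by fun_prop) m _).trans ?_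
        gcongr
    _ = ENNReal.ofReal (Real.exp (-(m * (t * (β - Λ) - t * η - η)))) := by
        rw [← ENNReal.ofReal_pow (Real.exp_pos _).le, ← ENNReal.ofReal_mul (Real.exp_pos _).le,
          ← Real.exp_nat_mul, ← Real.exp_add]
        congr 2; ring
    _ ≤ _ := by
        refine ENNReal.ofReal_le_ofReal (Real.exp_le_exp.2 (neg_le_neg (hn5.trans ?_)))
        exact mul_le_mul_of_nonneg_left (by nlinarith) hm0.le

/-- Over a compact set of starting points the summand has a uniform quadratic bound, so a large mean
forces a large sum of squares. -/
lemma transition_tight {g : Vec d → PSD d'} (hg : QuadraticIncrement g) (hα : 0 < α)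
    (hC : Tendsto (fun n : ℕ => (C n : ℝ) / (n : ℝ)) atTop (𝓝 α)) {K : Set (PSD d)}
    (hK : IsCompact K) (a : ℝ) :
    ∃ K' : Set (PSD d'), IsCompact K' ∧ ∀ᶠ n : ℕ in atTop, ∀ x ∈ K,
      transition g (C n) x K'ᶜ ≤ ENNReal.ofReal (Real.exp (-(n * a))) := by
  obtain ⟨A, hA0, hA⟩ := hg.exists_norm_le hK
  obtain ⟨t, ht0, ht⟩ := exists_lintegral_exp_sq_le d one_pos
  set b := (a + 1) / α with hb
  refine ⟨_, isCompact_norm_matVec_le (A * ((b + 1) / t)), ?_⟩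
  have h4 := (tendsto_atTop_of_div_tendsto hα hC).eventually (eventually_gt_atTop 0)
  have h5 := eventually_le_mul_of_div_tendsto (a := a) (b := b) hC (by
    rw [hb, mul_div_cancel₀ _ hα.ne']; linarith)
  filter_upwards [h4, h5] with n hn4 hn5 x hx
  set m := C n with hm
  have hm0 : (0 : ℝ) < m := by exact_mod_cast hn4
  rw [transition_apply hg.1 m x (isCompact_norm_matVec_le _).isClosed.measurableSet.compl]
  refine (measure_mono fun Z hZ => ?_).trans ((pi_le_sum_sq_le ht0 ht m b).trans
    (ENNReal.ofReal_le_ofReal (Real.exp_le_exp.2 (neg_le_neg hn5))))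
  rw [Set.mem_ofPred_eq, Set.mem_compl_iff, Set.mem_ofPred_eq, not_le, matVec_empMean, norm_smul,
    norm_inv, Real.norm_natCast, lt_inv_mul_iff₀ hm0] at hZ
  have h1 : ‖∑ c, matVec (g (sqrtMul x (Z c))).1‖ ≤ A * ∑ c, (1 + ‖Z c‖ ^ 2) := by
    rw [Finset.mul_sum]
    exact norm_sum_le_of_le _ fun c _ => hA x hx (Z c)
  have h2 : A * (m * ((b + 1) / t)) ≤ A * ∑ c, (1 + ‖Z c‖ ^ 2) := by
    refine le_trans (le_of_eq (by ring)) (hZ.le.trans h1)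
  exact le_of_mul_le_mul_left h2 hA0

end TransitionBounds

/-- Splits an exponent between the past and the next transition. If one rate is infinite, the other
share is `-1`, below any nonnegative rate. -/
lemma exists_real_add_eq_of_lt_add {R T : EReal} (hR : 0 ≤ R) (hT : 0 ≤ T) {a : ℝ}
    (h : (a : EReal) < R + T) :
    ∃ b c : ℝ, (b : EReal) < R ∧ (c : EReal) < T ∧ b + c = a := by
  have hneg : ∀ S : EReal, 0 ≤ S → ((-1 : ℝ) : EReal) < S := fun S hS =>
    lt_of_lt_of_le (by exact_mod_cast (by norm_num : (-1 : ℝ) < 0)) hS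
  induction R with
  | bot => simp at hR
  | top => exact ⟨a + 1, -1, EReal.coe_lt_top _, hneg T hT, by ring⟩
  | coe r =>
    induction T with
    | bot => simp at hT
    | top => exact ⟨-1, a + 1, hneg r hR, EReal.coe_lt_top _, by ring⟩
    | coe t =>
      have h' : a < r + t := by exact_mod_cast h
      refine ⟨r - (r + t - a) / 2, a - (r - (r + t - a) / 2), ?_, ?_, by ring⟩
      · rw [EReal.coe_lt_coe_iff]; linarith
      · rw [EReal.coe_lt_coe_iff]; linarith

lemma exists_real_add_eq_of_add_lt {R T : EReal} (hR : 0 ≤ R) (hT : 0 ≤ T) {a : ℝ}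
    (h : R + T < (a : EReal)) :
    ∃ b c : ℝ, R < (b : EReal) ∧ T < (c : EReal) ∧ b + c = a := by
  induction R with
  | bot => simp at hR
  | top =>
    rw [EReal.top_add_of_ne_bot (fun h0 => by simp [h0] at hT)] at h
    simp at h
  | coe r =>
    induction T with
    | bot => simp at hT
    | top => simp at h
    | coe t =>
      have h' : r + t < a := by exact_mod_cast h
      refine ⟨r + (a - r - t) / 2, a - (r + (a - r - t) / 2), ?_, ?_, by ring⟩
      · rw [EReal.coe_lt_coe_iff]; linarith
      · rw [EReal.coe_lt_coe_iff]; linarith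

/-! ### Induction along the Markov chain. -/

section Chain

variable {Ω : Type*} {L : ℕ} {D : Fin (L + 1) → ℕ}

/-- The event that the components of `X` with index at most `k` lie in the given sets. -/
def initialEvent (X : (i : Fin (L + 1)) → Ω → PSD (D i)) (k : Fin (L + 1))
    (U : (i : Fin (L + 1)) → Set (PSD (D i))) : Set Ω :=
  {ω | ∀ i ≤ k, X i ω ∈ U i}

lemma mem_initialEvent_succ {X : (i : Fin (L + 1)) → Ω → PSD (D i)} {ℓ : Fin L}
    {U : (i : Fin (L + 1)) → Set (PSD (D i))} {ω : Ω} :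
    ω ∈ initialEvent X ℓ.succ U ↔ ω ∈ initialEvent X ℓ.castSucc U ∧ X ℓ.succ ω ∈ U ℓ.succ := by
  refine ⟨fun h => ⟨fun i hi => h i (hi.trans Fin.castSucc_lt_succ.le), h _ le_rfl⟩,
    fun h i hi => ?_⟩
  rcases hi.eq_or_lt with rfl | hlt
  · exact h.2
  · exact h.1 i (Fin.le_castSucc_iff.2 hlt)

/-- The `σ`-algebra generated by the components of `X` with index at most `k`. -/
abbrev pastAlgebra (X : (i : Fin (L + 1)) → Ω → PSD (D i)) (k : Fin (L + 1)) : MeasurableSpace Ω :=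
  ⨆ i : {i : Fin (L + 1) // i ≤ k}, MeasurableSpace.comap (X i.1) inferInstance

lemma measurableSet_initialEvent (X : (i : Fin (L + 1)) → Ω → PSD (D i)) (k : Fin (L + 1))
    {U : (i : Fin (L + 1)) → Set (PSD (D i))} (hU : ∀ i, MeasurableSet (U i)) :
    MeasurableSet[pastAlgebra X k] (initialEvent X k U) := by
  have : initialEvent X k U = ⋂ i : {i : Fin (L + 1) // i ≤ k}, X i.1 ⁻¹' U i.1 := by
    ext ω; simp [initialEvent]
  rw [this]
  refine MeasurableSet.iInter fun i => ?_
  exact le_iSup (fun i : {i : Fin (L + 1) // i ≤ k} =>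
    MeasurableSpace.comap (X i.1) inferInstance) i _ ⟨U i.1, hU i.1, rfl⟩

variable [MeasurableSpace Ω] {P : Measure Ω}

namespace IsCovChain

variable {G : (ℓ : Fin L) → Vec (D ℓ.castSucc) → PSD (D ℓ.succ)} {C : Fin L → ℕ} {Q₀ : PSD (D 0)}
  {X : (i : Fin (L + 1)) → Ω → PSD (D i)}

lemma pastAlgebra_le (h : IsCovChain P G C Q₀ X) (k : Fin (L + 1)) :
    pastAlgebra X k ≤ ‹MeasurableSpace Ω› :=
  iSup_le fun i => (h.measurable i.1).comap_le

lemma measure_initialEvent_inter [IsProbabilityMeasure P] (h : IsCovChain P G C Q₀ X)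
    (hG : ∀ ℓ, Continuous (G ℓ)) (ℓ : Fin L) {U : (i : Fin (L + 1)) → Set (PSD (D i))}
    (hU : ∀ i, MeasurableSet (U i)) {B : Set (PSD (D ℓ.succ))} (hB : MeasurableSet B) :
    P (initialEvent X ℓ.castSucc U ∩ X ℓ.succ ⁻¹' B) =
      ∫⁻ ω in initialEvent X ℓ.castSucc U, transition (G ℓ) (C ℓ) (X ℓ.castSucc ω) B ∂P := by
  set A := initialEvent X ℓ.castSucc U with hA
  have hmle := h.pastAlgebra_le ℓ.castSucc
  have hAm : MeasurableSet[pastAlgebra X ℓ.castSucc] A := measurableSet_initialEvent X _ hU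
  have hXB : MeasurableSet (X ℓ.succ ⁻¹' B) := h.measurable _ hB
  have hint : Integrable ((X ℓ.succ ⁻¹' B).indicator fun _ => (1 : ℝ)) P :=
    (integrable_const _).indicator hXB
  have hmk := h.markov ℓ B hB
  have hprob := fun ω => isProbabilityMeasure_transition (hG ℓ) (C ℓ) (X ℓ.castSucc ω)
  -- Measurability and integrability of the kernel along the chain are inherited from the
  -- conditional expectation.
  have hint2 : Integrable (fun ω => (transition (G ℓ) (C ℓ) (X ℓ.castSucc ω)).real B) P :=
    integrable_condExp.congr hmk
  have h1 : ∫ ω in A, (transition (G ℓ) (C ℓ) (X ℓ.castSucc ω)).real B ∂P =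
      P.real (A ∩ X ℓ.succ ⁻¹' B) := by
    rw [← setIntegral_congr_ae (hmle _ hAm) (hmk.mono fun ω hω _ => hω),
      setIntegral_condExp hmle hint hAm, integral_indicator_const _ hXB, smul_eq_mul, mul_one,
      measureReal_restrict_apply hXB, Set.inter_comm]
  have h2 := ofReal_integral_eq_lintegral_ofReal (hint2.restrict (s := A))
    (Eventually.of_forall fun ω => measureReal_nonneg)
  rw [h1, ofReal_measureReal] at h2
  rw [h2]
  exact lintegral_congr fun ω => ofReal_measureReal

lemma mul_le_measure_inter [IsProbabilityMeasure P] (h : IsCovChain P G C Q₀ X)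
    (hG : ∀ ℓ, Continuous (G ℓ)) (ℓ : Fin L) {U : (i : Fin (L + 1)) → Set (PSD (D i))}
    (hU : ∀ i, MeasurableSet (U i)) {B : Set (PSD (D ℓ.succ))} (hB : MeasurableSet B) {c : ℝ≥0∞}
    (hc : ∀ x ∈ U ℓ.castSucc, c ≤ transition (G ℓ) (C ℓ) x B) :
    c * P (initialEvent X ℓ.castSucc U) ≤
      P (initialEvent X ℓ.castSucc U ∩ X ℓ.succ ⁻¹' B) := by
  rw [h.measure_initialEvent_inter hG ℓ hU hB, ← setLIntegral_const]
  have hm := h.pastAlgebra_le _ _ (measurableSet_initialEvent X ℓ.castSucc hU)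
  exact setLIntegral_mono' hm fun ω hω => hc _ (hω _ le_rfl)

lemma measure_inter_le_mul [IsProbabilityMeasure P] (h : IsCovChain P G C Q₀ X)
    (hG : ∀ ℓ, Continuous (G ℓ)) (ℓ : Fin L) {U : (i : Fin (L + 1)) → Set (PSD (D i))}
    (hU : ∀ i, MeasurableSet (U i)) {B : Set (PSD (D ℓ.succ))} (hB : MeasurableSet B) {c : ℝ≥0∞}
    (hc : ∀ x ∈ U ℓ.castSucc, transition (G ℓ) (C ℓ) x B ≤ c) :
    P (initialEvent X ℓ.castSucc U ∩ X ℓ.succ ⁻¹' B) ≤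
      c * P (initialEvent X ℓ.castSucc U) := by
  rw [h.measure_initialEvent_inter hG ℓ hU hB, ← setLIntegral_const]
  have hm := h.pastAlgebra_le _ _ (measurableSet_initialEvent X ℓ.castSucc hU)
  exact setLIntegral_mono' hm fun ω hω => hc _ (hω _ le_rfl)

end IsCovChain

/-- The family of sets that is `V` at the index `j` and everything elsewhere. -/
def constrainAt (j : Fin (L + 1)) (V : Set (PSD (D j))) (i : Fin (L + 1)) : Set (PSD (D i)) :=
  Function.update (β := fun i => Set (PSD (D i))) (fun _ => Set.univ) j V i

lemma constrainAt_self (j : Fin (L + 1)) (V : Set (PSD (D j))) : constrainAt j V j = V :=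
  Function.update_self ..

lemma isOpen_constrainAt {j : Fin (L + 1)} {V : Set (PSD (D j))} (hV : IsOpen V)
    (i : Fin (L + 1)) : IsOpen (constrainAt j V i) := by
  rcases eq_or_ne i j with rfl | hij
  · rwa [constrainAt_self]
  · rw [constrainAt, Function.update_of_ne hij]; exact isOpen_univ

lemma constrainAt_mem_nhds {j : Fin (L + 1)} {V : Set (PSD (D j))}
    {Q : (i : Fin (L + 1)) → PSD (D i)} (hV : V ∈ 𝓝 (Q j)) (i : Fin (L + 1)) :
    constrainAt j V i ∈ 𝓝 (Q i) := by
  rcases eq_or_ne i j with rfl | hij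
  · rwa [constrainAt_self]
  · rw [constrainAt, Function.update_of_ne hij]; exact univ_mem

/-- The part of the rate function of the chain that involves the first `k` transitions. -/
def initialRate (G : (ℓ : Fin L) → Vec (D ℓ.castSucc) → PSD (D ℓ.succ)) (α : Fin L → ℝ)
    (k : Fin (L + 1)) (Q : (i : Fin (L + 1)) → PSD (D i)) : EReal :=
  ∑ ℓ : Fin L with ℓ.castSucc < k, (α ℓ : EReal) * condRate (G ℓ) (Q ℓ.castSucc) (Q ℓ.succ)

variable {G : (ℓ : Fin L) → Vec (D ℓ.castSucc) → PSD (D ℓ.succ)} {α : Fin L → ℝ}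

lemma mul_condRate_nonneg (hα : ∀ ℓ, 0 < α ℓ) (ℓ : Fin L) (x : PSD (D ℓ.castSucc))
    (y : PSD (D ℓ.succ)) : 0 ≤ (α ℓ : EReal) * condRate (G ℓ) x y :=
  mul_nonneg (by exact_mod_cast (hα ℓ).le) (condRate_nonneg _ _ _)

lemma initialRate_nonneg (hα : ∀ ℓ, 0 < α ℓ) (k : Fin (L + 1))
    (Q : (i : Fin (L + 1)) → PSD (D i)) : 0 ≤ initialRate G α k Q :=
  Finset.sum_nonneg fun ℓ _ => mul_condRate_nonneg hα ℓ _ _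

lemma initialRate_zero (Q : (i : Fin (L + 1)) → PSD (D i)) : initialRate G α 0 Q = 0 := by
  simp [initialRate]

lemma initialRate_succ (ℓ : Fin L) (Q : (i : Fin (L + 1)) → PSD (D i)) :
    initialRate G α ℓ.succ Q = initialRate G α ℓ.castSucc Q +
      (α ℓ : EReal) * condRate (G ℓ) (Q ℓ.castSucc) (Q ℓ.succ) := by
  have h : (Finset.univ.filter fun j : Fin L => j.castSucc < ℓ.succ) =
      insert ℓ (Finset.univ.filter fun j : Fin L => j.castSucc < ℓ.castSucc) := by
    ext j
    simp only [Finset.mem_filter, Finset.mem_univ, true_and, Finset.mem_insert,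
      Fin.castSucc_lt_castSucc_iff, Fin.castSucc_lt_succ_iff]
    rw [le_iff_eq_or_lt]
  rw [initialRate, h, Finset.sum_insert (by simp), add_comm]
  rfl

lemma initialRate_last (Q₀ : PSD (D 0)) (Q : (ℓ : Fin L) → PSD (D ℓ.succ)) :
    initialRate G α (Fin.last L) (Fin.cons (α := fun i => PSD (D i)) Q₀ Q) =
      chainRate G α Q₀ Q := by
  simp [initialRate, chainRate, Fin.castSucc_lt_last]

variable {K₁ : PSD (D 0)}

lemma IsCovChain.ae_mem_initialEvent_zero {C : Fin L → ℕ} {X : (i : Fin (L + 1)) → Ω → PSD (D i)}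
    (h : IsCovChain P G C K₁ X) {U : (i : Fin (L + 1)) → Set (PSD (D i))} (hU : K₁ ∈ U 0) :
    ∀ᵐ ω ∂P, ω ∈ initialEvent X 0 U := by
  filter_upwards [h.init] with ω hω i hi
  obtain rfl : i = 0 := Fin.le_zero_iff.1 hi
  rwa [hω]

variable [IsProbabilityMeasure P] {C : Fin L → ℕ → ℕ}
  {K : ℕ → (i : Fin (L + 1)) → Ω → PSD (D i)}

/-- The induction needs arbitrary neighbourhoods `U`: each step shrinks the one at `ℓ` to where the
transition bound is uniform, then multiplies the two bounds. -/
lemma eventually_exp_neg_le_measure_initialEvent (hG : ∀ ℓ, QuadraticIncrement (G ℓ))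
    (hα : ∀ ℓ, 0 < α ℓ)
    (hC : ∀ ℓ, Tendsto (fun n : ℕ => (C ℓ n : ℝ) / (n : ℝ)) atTop (𝓝 (α ℓ)))
    (hK : ∀ n, 1 ≤ n → IsCovChain P G (fun ℓ => C ℓ n) K₁ (K n)) (k : Fin (L + 1))
    {Q : (i : Fin (L + 1)) → PSD (D i)} (hQ : Q 0 = K₁) {a : ℝ} (ha : initialRate G α k Q < a)
    {U : (i : Fin (L + 1)) → Set (PSD (D i))} (hU : ∀ i, U i ∈ 𝓝 (Q i)) :
    ∀ᶠ n : ℕ in atTop, ENNReal.ofReal (Real.exp (-(n * a))) ≤ P (initialEvent (K n) k U) := by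
  induction k using Fin.induction generalizing a U with
  | zero =>
    rw [initialRate_zero] at ha
    have ha' : 0 < a := by exact_mod_cast ha
    filter_upwards [eventually_ge_atTop 1] with n hn
    have hone : P (initialEvent (K n) 0 U) = 1 := by
      rw [← measure_univ (μ := P)]
      refine measure_congr (eventuallyEq_univ.2 ?_)
      exact (hK n hn).ae_mem_initialEvent_zero (hQ ▸ mem_of_mem_nhds (hU 0))
    rw [hone]
    refine ENNReal.ofReal_le_one.2 (Real.exp_le_one_iff.2 ?_)
    have : (0 : ℝ) ≤ n * a := by positivity
    linarith
  | succ ℓ ih =>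
    rw [initialRate_succ] at ha
    obtain ⟨b, c, hb, hc, rfl⟩ := exists_real_add_eq_of_add_lt (initialRate_nonneg hα _ _)
      (mul_condRate_nonneg hα ℓ _ _) ha
    obtain ⟨U', hU', htr⟩ := transition_lower (hG ℓ) (hα ℓ) (hC ℓ) hc
      (interior_mem_nhds.2 (hU ℓ.succ))
    set W : (i : Fin (L + 1)) → Set (PSD (D i)) := fun i =>
      interior (U i) ∩ constrainAt ℓ.castSucc (interior U') i with hW
    have hWo : ∀ i, IsOpen (W i) := fun i =>
      isOpen_interior.inter (isOpen_constrainAt isOpen_interior i)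
    have hWn : ∀ i, W i ∈ 𝓝 (Q i) := fun i =>
      inter_mem (interior_mem_nhds.2 (hU i)) (constrainAt_mem_nhds (interior_mem_nhds.2 hU') i)
    filter_upwards [ih hb hWn, htr, eventually_ge_atTop 1] with n h1 h2 hn
    have hstep := (hK n hn).mul_le_measure_inter (fun ℓ => (hG ℓ).1) ℓ
      (fun i => (hWo i).measurableSet) (isOpen_interior (s := U ℓ.succ)).measurableSet
      (c := ENNReal.ofReal (Real.exp (-(n * c)))) fun x hx => h2 x (interior_subset (by
        have := hx.2
        rwa [constrainAt_self] at this))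
    calc ENNReal.ofReal (Real.exp (-(n * (b + c))))
        = ENNReal.ofReal (Real.exp (-(n * c))) * ENNReal.ofReal (Real.exp (-(n * b))) := by
          rw [← ENNReal.ofReal_mul (Real.exp_pos _).le, ← Real.exp_add]
          congr 2; ring
      _ ≤ _ := (mul_le_mul_right h1 _).trans hstep
      _ ≤ _ := measure_mono fun ω hω => mem_initialEvent_succ.2
          ⟨fun i hi => interior_subset (hω.1 i hi).1, interior_subset hω.2⟩

lemma exists_measure_initialEvent_le_exp_neg (hG : ∀ ℓ, QuadraticIncrement (G ℓ))
    (hα : ∀ ℓ, 0 < α ℓ)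
    (hC : ∀ ℓ, Tendsto (fun n : ℕ => (C ℓ n : ℝ) / (n : ℝ)) atTop (𝓝 (α ℓ)))
    (hK : ∀ n, 1 ≤ n → IsCovChain P G (fun ℓ => C ℓ n) K₁ (K n)) (k : Fin (L + 1))
    {Q : (i : Fin (L + 1)) → PSD (D i)} {a : ℝ} (ha : a < initialRate G α k Q) :
    ∃ U : (i : Fin (L + 1)) → Set (PSD (D i)), (∀ i, U i ∈ 𝓝 (Q i)) ∧
      ∀ᶠ n : ℕ in atTop, P (initialEvent (K n) k U) ≤ ENNReal.ofReal (Real.exp (-(n * a))) := by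
  induction k using Fin.induction generalizing a with
  | zero =>
    rw [initialRate_zero] at ha
    have ha' : a < 0 := by exact_mod_cast ha
    refine ⟨fun _ => Set.univ, fun _ => univ_mem, Eventually.of_forall fun n => ?_⟩
    refine prob_le_one.trans (ENNReal.one_le_ofReal.2 (Real.one_le_exp ?_))
    have := mul_nonpos_of_nonneg_of_nonpos (Nat.cast_nonneg (α := ℝ) n) ha'.le
    linarith
  | succ ℓ ih =>
    rw [initialRate_succ] at ha
    obtain ⟨b, c, hb, hc, rfl⟩ := exists_real_add_eq_of_lt_add (initialRate_nonneg hα _ _)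
      (mul_condRate_nonneg hα ℓ _ _) ha
    obtain ⟨U, hU, hle⟩ := ih hb
    obtain ⟨U', hU', V, hV, htr⟩ := transition_upper (hG ℓ) (hα ℓ) (hC ℓ) hc
    set W : (i : Fin (L + 1)) → Set (PSD (D i)) := fun i =>
      interior (U i) ∩ constrainAt ℓ.castSucc (interior U') i with hW
    have hWo : ∀ i, IsOpen (W i) := fun i =>
      isOpen_interior.inter (isOpen_constrainAt isOpen_interior i)
    have hWn : ∀ i, W i ∈ 𝓝 (Q i) := fun i =>
      inter_mem (interior_mem_nhds.2 (hU i)) (constrainAt_mem_nhds (interior_mem_nhds.2 hU') i)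
    have hsub : ∀ n, initialEvent (K n) ℓ.castSucc W ⊆ initialEvent (K n) ℓ.castSucc U :=
      fun n ω hω i hi => interior_subset (hω i hi).1
    refine ⟨fun i => W i ∩ constrainAt ℓ.succ (interior V) i, fun i =>
      inter_mem (hWn i) (constrainAt_mem_nhds (interior_mem_nhds.2 hV) i), ?_⟩
    filter_upwards [hle, htr, eventually_ge_atTop 1] with n h1 h2 hn
    have hstep := (hK n hn).measure_inter_le_mul (fun ℓ => (hG ℓ).1) ℓ
      (fun i => (hWo i).measurableSet) (isOpen_interior (s := V)).measurableSet
      (c := ENNReal.ofReal (Real.exp (-(n * c)))) fun x hx =>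
        (measure_mono interior_subset).trans (h2 x (interior_subset (by
          have := hx.2
          rwa [constrainAt_self] at this)))
    calc _ ≤ P (initialEvent (K n) ℓ.castSucc W ∩ K n ℓ.succ ⁻¹' interior V) :=
          measure_mono fun ω hω => by
            rw [mem_initialEvent_succ] at hω
            refine ⟨fun i hi => (hω.1 i hi).1, ?_⟩
            have := hω.2.2
            rwa [constrainAt_self] at this
      _ ≤ ENNReal.ofReal (Real.exp (-(n * c))) * ENNReal.ofReal (Real.exp (-(n * b))) :=
          hstep.trans (mul_le_mul_right ((measure_mono (hsub n)).trans h1) _)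
      _ = _ := by
          rw [← ENNReal.ofReal_mul (Real.exp_pos _).le, ← Real.exp_add]
          congr 2; ring

lemma exists_isCompact_measure_compl_initialEvent_le (hG : ∀ ℓ, QuadraticIncrement (G ℓ))
    (hα : ∀ ℓ, 0 < α ℓ)
    (hC : ∀ ℓ, Tendsto (fun n : ℕ => (C ℓ n : ℝ) / (n : ℝ)) atTop (𝓝 (α ℓ)))
    (hK : ∀ n, 1 ≤ n → IsCovChain P G (fun ℓ => C ℓ n) K₁ (K n)) (k : Fin (L + 1)) (a : ℝ) :
    ∃ S : (i : Fin (L + 1)) → Set (PSD (D i)), (∀ i, IsCompact (S i)) ∧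
      ∀ᶠ n : ℕ in atTop, P (initialEvent (K n) k S)ᶜ ≤ ENNReal.ofReal (Real.exp (-(n * a))) := by
  induction k using Fin.induction generalizing a with
  | zero =>
    refine ⟨Function.update (fun _ => ∅) 0 {K₁}, fun i => ?_, ?_⟩
    · rcases eq_or_ne i 0 with rfl | hi
      · rw [Function.update_self]; exact isCompact_singleton
      · rw [Function.update_of_ne hi]; exact isCompact_empty
    · filter_upwards [eventually_ge_atTop 1] with n hn
      refine le_trans (le_of_eq ?_) zero_le
      exact (hK n hn).ae_mem_initialEvent_zero (by simp)
  | succ ℓ ih =>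
    -- Past and next component may each fail; the extra one in the exponent absorbs the resulting
    -- factor two.
    obtain ⟨S, hS, hle⟩ := ih (a + 1)
    obtain ⟨T, hT, htr⟩ := transition_tight (hG ℓ) (hα ℓ) (hC ℓ) (hS ℓ.castSucc) (a + 1)
    refine ⟨Function.update S ℓ.succ T, fun i => ?_, ?_⟩
    · rcases eq_or_ne i ℓ.succ with rfl | hi
      · rwa [Function.update_self]
      · rw [Function.update_of_ne hi]; exact hS i
    · filter_upwards [hle, htr, eventually_ge_atTop 1,
        eventually_const_mul_exp_neg_le 2 (lt_add_one a)] with n h1 h2 hn h3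
      have hstep := (hK n hn).measure_inter_le_mul (fun ℓ => (hG ℓ).1) ℓ
        (fun i => (hS i).isClosed.measurableSet) hT.isClosed.measurableSet.compl h2
      calc _ ≤ P ((initialEvent (K n) ℓ.castSucc S)ᶜ ∪
            (initialEvent (K n) ℓ.castSucc S ∩ K n ℓ.succ ⁻¹' Tᶜ)) := by
            refine measure_mono fun ω hω => ?_
            by_cases hS' : ω ∈ initialEvent (K n) ℓ.castSucc S
            · refine Or.inr ⟨hS', fun hωT => hω (mem_initialEvent_succ.2 ⟨fun i hi => ?_, ?_⟩)⟩
              · rw [Function.update_of_ne (hi.trans_lt Fin.castSucc_lt_succ).ne]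
                exact hS' i hi
              · rwa [Function.update_self]
            · exact Or.inl hS'
        _ ≤ ENNReal.ofReal (Real.exp (-(n * (a + 1)))) +
            ENNReal.ofReal (Real.exp (-(n * (a + 1)))) :=
            (measure_union_le _ _).trans (add_le_add h1
              (hstep.trans (mul_le_of_le_one_right' prob_le_one)))
        _ = ENNReal.ofReal 2 * ENNReal.ofReal (Real.exp (-(n * (a + 1)))) := by
            rw [← two_mul]; simp
        _ ≤ _ := h3

/-- The bounds for all `L + 1` components are read off with `K₁` prepended. Restricting component
`0` to a neighbourhood of `K₁` costs nothing, since it equals `K₁` almost surely. -/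
lemma satisfiesPointwiseLDP_chainRate (hG : ∀ ℓ, QuadraticIncrement (G ℓ))
    (hα : ∀ ℓ, 0 < α ℓ)
    (hC : ∀ ℓ, Tendsto (fun n : ℕ => (C ℓ n : ℝ) / (n : ℝ)) atTop (𝓝 (α ℓ)))
    (hK : ∀ n, 1 ≤ n → IsCovChain P G (fun ℓ => C ℓ n) K₁ (K n)) :
    SatisfiesPointwiseLDP (fun n : ℕ => P.map fun ω (ℓ : Fin L) => K n ℓ.succ ω)
      (chainRate G α K₁) := by
  have hmeas : ∀ n, 1 ≤ n → Measurable fun ω (ℓ : Fin L) => K n ℓ.succ ω := fun n hn =>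
    measurable_pi_lambda _ fun ℓ => (hK n hn).measurable _
  refine ⟨fun q a ha U hU => ?_, fun q a ha => ?_, fun a => ?_⟩
  · rw [nhds_pi, Filter.mem_pi] at hU
    obtain ⟨I, -, V, hV, hVU⟩ := hU
    have hnhds : ∀ i, Fin.cons (α := fun i => Set (PSD (D i))) Set.univ V i ∈
        𝓝 (Fin.cons (α := fun i => PSD (D i)) K₁ q i) := fun i => by
      cases i using Fin.cases with
      | zero => exact univ_mem
      | succ ℓ => exact hV ℓ
    rw [← initialRate_last] at ha
    filter_upwards [eventually_exp_neg_le_measure_initialEvent hG hα hC hK _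
      (Fin.cons_zero ..) ha hnhds, eventually_ge_atTop 1] with n h1 hn
    refine h1.trans (le_trans (measure_mono fun ω hω => ?_)
      (Measure.le_map_apply (hmeas n hn).aemeasurable U))
    exact hVU fun ℓ _ => hω ℓ.succ (Fin.le_last _)
  · rw [← initialRate_last] at ha
    obtain ⟨U, hU, hle⟩ := exists_measure_initialEvent_le_exp_neg hG hα hC hK _ ha
    set V : Set ((ℓ : Fin L) → PSD (D ℓ.succ)) := Set.univ.pi fun ℓ => interior (U ℓ.succ) with hV
    have hVo : IsOpen V := isOpen_set_pi Set.finite_univ fun _ _ => isOpen_interior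
    refine ⟨V, hVo.mem_nhds fun ℓ _ => mem_interior_iff_mem_nhds.2 (hU ℓ.succ), ?_⟩
    filter_upwards [hle, eventually_ge_atTop 1] with n h1 hn
    rw [Measure.map_apply (hmeas n hn) hVo.measurableSet]
    refine le_trans (measure_mono_ae ?_) h1
    filter_upwards [(hK n hn).init] with ω hω hωV i _
    cases i using Fin.cases with
    | zero => rw [hω]; exact mem_of_mem_nhds (hU 0)
    | succ ℓ => exact interior_subset (hωV ℓ trivial)
  · obtain ⟨S, hS, hle⟩ :=
      exists_isCompact_measure_compl_initialEvent_le hG hα hC hK (Fin.last L) a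
    have hcpt : IsCompact (Set.univ.pi fun ℓ : Fin L => S ℓ.succ) :=
      isCompact_univ_pi fun ℓ => hS ℓ.succ
    refine ⟨_, hcpt, ?_⟩
    filter_upwards [hle, eventually_ge_atTop 1] with n h1 hn
    rw [Measure.map_apply (hmeas n hn) hcpt.isClosed.measurableSet.compl]
    refine le_trans (measure_mono ?_) h1
    intro ω hω hω'
    refine hω fun ℓ _ => ?_
    exact hω' ℓ.succ (Fin.le_last _)

lemma chainRate_ne_bot (hα : ∀ ℓ, 0 < α ℓ) (Q₀ : PSD (D 0)) (Q : (ℓ : Fin L) → PSD (D ℓ.succ)) :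
    chainRate G α Q₀ Q ≠ ⊥ := by
  rw [← initialRate_last]
  exact ((EReal.bot_lt_zero).trans_le (initialRate_nonneg hα _ _)).ne'

end Chain

end CovLDP

end

theorem mainTheorem2 {Ω : Type*} [MeasurableSpace Ω] (P : Measure Ω) [IsProbabilityMeasure P]
    (L : ℕ) (D : Fin (L + 1) → ℕ)
    (G : (ℓ : Fin L) → CovLDP.Vec (D ℓ.castSucc) → CovLDP.PSD (D ℓ.succ))
    (hG : ∀ ℓ, CovLDP.QuadraticIncrement (G ℓ))
    (C : Fin L → ℕ → ℕ) (α : Fin L → ℝ) (hα : ∀ ℓ, 0 < α ℓ)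
    (hC : ∀ ℓ, Tendsto (fun n : ℕ => (C ℓ n : ℝ) / (n : ℝ)) atTop (𝓝 (α ℓ)))
    (K₁ : CovLDP.PSD (D 0))
    (K : ℕ → (i : Fin (L + 1)) → Ω → CovLDP.PSD (D i))
    (hK : ∀ n, 1 ≤ n → CovLDP.IsCovChain P G (fun ℓ => C ℓ n) K₁ (K n)) :
    CovLDP.IsGoodRateFunction (CovLDP.chainRate G α K₁) ∧
      CovLDP.SatisfiesLDP (fun n : ℕ => P.map fun ω (ℓ : Fin L) => K n ℓ.succ ω)
        (CovLDP.chainRate G α K₁) := by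
  have h := CovLDP.satisfiesPointwiseLDP_chainRate hG hα hC hK
  exact ⟨h.isGoodRateFunction (CovLDP.chainRate_ne_bot hα K₁), h.satisfiesLDP⟩
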